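/- Let $\Omega=(0,1)$, $k\ge 0$, let $b$ and $\sigma$ be $1$-periodic real functions on $\mathbb R$, $b$ Lipschitz continuous and $\sigma$ of class $C^{2k+2}$. For $M\ge 1$ put $\Delta x=1/M$, $I_i=(i\Delta x,(i+1)\Delta x)$, and let $V_k$ be the space of functions on $(0,1)$, extended $1$-periodically, whose restriction to each $I_i$, $0\le i<M$, is a polynomial of degree at most $k$; $(\cdot,\cdot)$ and $\|\cdot\|$ denote the scalar product and the norm of $L^2(0,1)$. For $h>0$ and $q\in\mathbb R$ let $\gamma^q_h(x)=x+b(x)h+q\,\sigma(x)\sqrt h$. SLDG-1 uses $q\in\{-1,1\}$, weights $\alpha_{\pm1}=\frac12$ and characteristics $y^q_h=\gamma^q_h$. SLDG-2 uses $q\in\{-1,0,1\}$, weights $\alpha_{\pm1}=\frac16$, $\alpha_0=\frac23$ and $$y^q_h=x+\tfrac12\big(b(\gamma^{\sqrt3 q}_h)+b\big)h+\tfrac14\Big[\big(\sigma(\gamma^1_h)+\sigma(\gamma^{-1}_h)+2\sigma\big)\sqrt3\,q+\big(\sigma(\gamma^1_h)-\sigma(\gamma^{-1}_h)\big)(3q^2-1)\Big]\sqrt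 h .$$ The scheme with exact integration maps $u\in V_k$ to the $L^2$ projection $S_{\Delta t}u\in V_k$ of $\sum_q\alpha_q\,u(y^q_{\Delta t}(\cdot))$. For the fully discrete scheme one takes, for each $q$, a finite partition of $(0,1)$ into intervals $J$ each of which is contained in some $I_i$ and is mapped by $y^q_{\Delta t}$ into a cell of the periodically extended mesh; $(f,g)_{G^q}$ is the sum over these $J$ of the $(k+1)$-point Gauss quadrature rule on $J$ applied to $fg$, and $\widetilde S_{\Delta t}u\in V_k$ is defined by $(\widetilde S_{\Delta t}u,\varphi)=\sum_q\alpha_q\,(u(y^q_{\Delta t}),\varphi)_{G^q}$ for all $\varphi\in V_k$. Let $h_0>0$ satisfy, for SLDG-1, $\|h_0b'+q\sqrt{h_0}\,\sigma'\|_{L^\infty}<1$ for $q=\pm1$ and, for SLDG-2, $h_0\|b'\|_{L^\infty}+3\sqrt{h_0}\,\|\sigma'\|_{L^\infty}<1$. Then for each of the two schemes: (i) There is a constant $C\ge0$ such that for all $0<\Delta t\le h_0$, all $M\ge1$ and all $u\in V_k$, $S_{\Delta t}u$ exists, is unique, and $\|S_{\Delta t}u\|\le(1+C\Delta t)\|u\|$.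 (ii) There is a constant $C\ge0$ such that for all $0<\Delta t\le h_0$ and all $M\ge1$, partitions as above exist, and for every choice of them and all $u\in V_k$, $\widetilde S_{\Delta t}u$ exists, is unique, and $\|\widetilde S_{\Delta t}u\|\le(1+C\Delta t+C\sqrt{\Delta t}\,\Delta x^2)\|u\|$. (iii) The fully discrete scheme is $L^2$-stable under the weak CFL condition: for every $\lambda>0$ there is $L\ge0$ such that for all $0<\Delta t\le h_0$ and $M\ge1$ with $\Delta x^4\le\lambda\Delta t$, all partitions as above and all $u^0\in V_k$, the iterates $u^{n+1}=\widetilde S_{\Delta t}u^n$ satisfy $\|u^n\|\le e^{L\,n\Delta t}\|u^0\|$ for all $n\ge0$. The constants do not depend on $\Delta t$, $M$, $u$, $n$ or the partitions. -/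

import Mathlib

open Set MeasureTheory

/-- The discontinuous Galerkin space `V_k` on `(0, 1)` for the uniform mesh with `M` cells,
extended `1`-periodically: on each cell the function is a polynomial of degree at most `k`.
(An `L²` class is represented by its right-continuous representative; no value at a mesh point is
ever seen by the integrals or by the quadrature points below.) -/
def dgSpace (k M : ℕ) : Set (ℝ → ℝ) :=
  {u | Function.Periodic u 1 ∧ ∀ i : ℕ, i < M → ∃ p : Polynomial ℝ, p.natDegree ≤ k ∧
    ∀ x ∈ Ico ((i : ℝ) / M) (((i : ℝ) + 1) / M), u x = p.eval x}

/-- The norm of `L²(0, 1)`. -/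
noncomputable def l2norm (u : ℝ → ℝ) : ℝ := Real.sqrt (∫ x in (0 : ℝ)..1, u x ^ 2)

/-- The Gauss quadrature rule with `k + 1` points on `(-1, 1)`: positive weights, and exactness on
polynomials of degree at most `2 k + 1` (this determines the rule up to a permutation). -/
structure GaussRule (k : ℕ) where
  point : Fin (k + 1) → ℝ
  weight : Fin (k + 1) → ℝ
  point_mem : ∀ a, point a ∈ Ioo (-1 : ℝ) 1
  weight_pos : ∀ a, 0 < weight a
  exact : ∀ p : Polynomial ℝ, p.natDegree ≤ 2 * k + 1 →
    ∫ x in (-1 : ℝ)..1, p.eval x = ∑ a, weight a * p.eval (point a)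

/-- Integration over `(-1, 1)` as a linear functional on polynomials. -/
noncomputable def polyInt : Polynomial ℝ →ₗ[ℝ] ℝ where
  toFun p := ∫ x in (-1 : ℝ)..1, p.eval x
  map_add' p q := by
    simp only [Polynomial.eval_add]
    exact intervalIntegral.integral_add (p.continuous.intervalIntegrable _ _)
      (q.continuous.intervalIntegrable _ _)
  map_smul' c p := by
    simp only [Polynomial.eval_smul, smul_eq_mul, RingHom.id_apply]
    exact intervalIntegral.integral_const_mul _ _

theorem polyInt_pos {p : Polynomial ℝ} (hp : p ≠ 0) (h : ∀ x ∈ Icc (-1 : ℝ) 1, 0 ≤ p.eval x) :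
    0 < polyInt p := by
  refine intervalIntegral.integral_pos (by norm_num) p.continuous.continuousOn
    (fun x hx => h x (Ioc_subset_Icc_self hx)) ?_
  by_contra! hcon
  refine hp (Polynomial.eq_zero_of_infinite_isRoot p ?_)
  refine (Icc_infinite (by norm_num : (-1 : ℝ) < 1)).mono fun x hx => ?_
  exact le_antisymm (hcon x hx) (h x hx)

theorem exists_orthogonal_poly (k : ℕ) : ∃ q : Polynomial ℝ, q ≠ 0 ∧ q.natDegree ≤ k + 1 ∧
    ∀ p : Polynomial ℝ, p.natDegree ≤ k → polyInt (q * p) = 0 := by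
  let T : Polynomial.degreeLT ℝ (k + 2) →ₗ[ℝ] (Fin (k + 1) → ℝ) :=
    LinearMap.pi fun i => polyInt ∘ₗ LinearMap.mulRight ℝ ((Polynomial.X : Polynomial ℝ) ^ (i : ℕ)) ∘ₗ
      (Polynomial.degreeLT ℝ (k + 2)).subtype
  have hfr : Module.finrank ℝ (Polynomial.degreeLT ℝ (k + 2)) = k + 2 := by
    rw [(Polynomial.degreeLTEquiv ℝ (k + 2)).finrank_eq]; simp
  have : FiniteDimensional ℝ (Polynomial.degreeLT ℝ (k + 2)) :=
    (Polynomial.degreeLTEquiv ℝ (k + 2)).symm.finiteDimensional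
  have hker : LinearMap.ker T ≠ ⊥ := LinearMap.ker_ne_bot_of_finrank_lt (by rw [hfr]; simp)
  obtain ⟨q, hq, hq0⟩ := Submodule.exists_mem_ne_zero_of_ne_bot hker
  have hq0' : (q : Polynomial ℝ) ≠ 0 := fun h => hq0 (Subtype.ext h)
  refine ⟨q, hq0', ?_, fun p hp => ?_⟩
  · have := Polynomial.mem_degreeLT.1 q.2
    have := (Polynomial.natDegree_lt_iff_degree_lt hq0').2 this
    omega
  · rw [p.as_sum_range' (k + 1) (by omega), Finset.mul_sum, map_sum]
    refine Finset.sum_eq_zero fun i hi => ?_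
    have h1 : T q ⟨i, Finset.mem_range.1 hi⟩ = 0 := by
      rw [LinearMap.mem_ker.1 hq]; rfl
    have h2 : polyInt ((q : Polynomial ℝ) * Polynomial.X ^ i) = 0 := h1
    rw [← Polynomial.C_mul_X_pow_eq_monomial, ← Polynomial.smul_eq_C_mul, mul_smul_comm, map_smul,
      h2, smul_zero]

/-- A Gauss rule with `k + 1` points exists. -/
theorem GaussRule.nonempty (k : ℕ) : Nonempty (GaussRule k) := by
  obtain ⟨q, hq0, hqd, horth⟩ := exists_orthogonal_poly k
  have key : ∀ d : Polynomial ℝ, d ∣ q → 1 ≤ d.natDegree →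
      (∀ x ∈ Icc (-1 : ℝ) 1, 0 ≤ d.eval x) → False := by
    rintro d ⟨g, rfl⟩ hd hpos
    have hd0 := left_ne_zero_of_mul hq0
    have hg0 := right_ne_zero_of_mul hq0
    have h1 := Polynomial.natDegree_mul hd0 hg0
    have h2 := horth g (by omega)
    have h3 : 0 < polyInt (d * g * g) := polyInt_pos (mul_ne_zero hq0 hg0) fun x hx => by
      simp only [Polynomial.eval_mul, mul_assoc]
      exact mul_nonneg (hpos x hx) (mul_self_nonneg _)
    exact h3.ne' h2
  have hdeg : q.natDegree = k + 1 := by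
    by_contra hne
    have h2 := horth q (by omega)
    have h3 : 0 < polyInt (q * q) := polyInt_pos (mul_ne_zero hq0 hq0) fun x hx => by
      simp only [Polynomial.eval_mul]
      exact mul_self_nonneg _
    exact h3.ne' h2
  have hsplit : q.Splits := by
    refine Polynomial.splits_iff_splits.2 (Or.inr fun {g} hg hgq => ?_)
    by_contra hg1
    have hgpos := hg.natDegree_pos
    have hroot : ∀ x, g.eval x ≠ 0 := fun x hx =>
      hg1 (Polynomial.degree_eq_one_of_irreducible_of_root hg hx)
    have hsign : (∀ x, 0 < g.eval x) ∨ (∀ x, g.eval x < 0) := by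
      by_contra! hcon
      obtain ⟨⟨x, hx⟩, ⟨y, hy⟩⟩ := hcon
      obtain ⟨z, hz⟩ := mem_range_of_exists_le_of_exists_ge g.continuous ⟨x, hx⟩ ⟨y, hy⟩
      exact hroot z hz
    rcases hsign with h | h
    · exact key g hgq hgpos fun x _ => (h x).le
    · exact key (-g) (neg_dvd.2 hgq) (by rw [Polynomial.natDegree_neg]; exact hgpos)
        fun x _ => by simpa using (h x).le
  have hcard : q.roots.card = k + 1 := by rw [← hdeg, hsplit.natDegree_eq_card_roots]
  have hnodup : q.roots.Nodup := by
    refine Multiset.nodup_iff_count_le_one.2 fun a => ?_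
    rw [Polynomial.count_roots]
    by_contra! hlt
    have hdvd : (Polynomial.X - Polynomial.C a) ^ 2 ∣ q :=
      (Polynomial.le_rootMultiplicity_iff hq0).1 hlt
    refine key _ hdvd (by simp [Polynomial.natDegree_pow]) fun x _ => by simp [sq_nonneg]
  have hmem : ∀ a ∈ q.roots, a ∈ Ioo (-1 : ℝ) 1 := by
    intro a ha
    have hdvd := Polynomial.dvd_iff_isRoot.2 (Polynomial.isRoot_of_mem_roots ha)
    by_contra hcon
    rw [mem_Ioo, not_and_or, not_lt, not_lt] at hcon
    rcases hcon with h | h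
    · exact key _ hdvd (by simp) fun x hx => by simp; linarith [hx.1]
    · exact key _ (neg_dvd.2 hdvd) (by rw [Polynomial.natDegree_neg]; simp)
        fun x hx => by simp; linarith [hx.2]
  have hfin : q.roots.toFinset.card = k + 1 := by rw [Multiset.toFinset_card_of_nodup hnodup, hcard]
  let v : Fin (k + 1) → ℝ := q.roots.toFinset.orderEmbOfFin hfin
  have hvinj : Function.Injective v := (q.roots.toFinset.orderEmbOfFin hfin).injective
  have hv : ∀ a, v a ∈ q.roots := fun a =>
    Multiset.mem_toFinset.1 (Finset.orderEmbOfFin_mem _ hfin a)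
  have hvz : ∀ a, q.eval (v a) = 0 := fun a => Polynomial.isRoot_of_mem_roots (hv a)
  have hinjOn : Set.InjOn v (Finset.univ : Finset (Fin (k + 1))) := hvinj.injOn
  let w : Fin (k + 1) → ℝ := fun a => polyInt (Lagrange.basis Finset.univ v a)
  have hexact : ∀ p : Polynomial ℝ, p.natDegree ≤ 2 * k + 1 →
      polyInt p = ∑ a, w a * p.eval (v a) := by
    intro p hp
    have hpq : p = q * (p / q) + p % q := (EuclideanDomain.div_add_mod p q).symm
    have h1 : polyInt (q * (p / q)) = 0 := horth _ (by
      rcases lt_or_ge p.degree q.degree with hlt | hge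
      · rw [(Polynomial.div_eq_zero_iff hq0).2 hlt]; simp
      · have h := Polynomial.degree_add_div hq0 hge
        have hp0 : p ≠ 0 := fun h0 => by
          rw [h0, Polynomial.degree_zero, le_bot_iff, Polynomial.degree_eq_bot] at hge
          exact hq0 hge
        have hpd : p / q ≠ 0 := fun h0 => by
          rw [h0, Polynomial.degree_zero, WithBot.add_bot] at h
          exact hp0 (Polynomial.degree_eq_bot.1 h.symm)
        rw [← Polynomial.degree_mul] at h
        have h' := Polynomial.natDegree_eq_of_degree_eq h
        rw [Polynomial.natDegree_mul hq0 hpd] at h'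
        omega)
    have hev : ∀ a, p.eval (v a) = (p % q).eval (v a) := fun a => by
      conv_lhs => rw [hpq]
      simp [hvz]
    have h2 : (p % q).degree < (Finset.univ : Finset (Fin (k + 1))).card := by
      have := Polynomial.degree_mod_lt p hq0
      rw [Polynomial.degree_eq_natDegree hq0, hdeg] at this
      simpa using this
    have h3 := Lagrange.eq_interpolate hinjOn h2
    conv_lhs => rw [hpq, map_add, h1, zero_add, h3, Lagrange.interpolate_apply, map_sum]
    refine Finset.sum_congr rfl fun a _ => ?_
    rw [← Polynomial.smul_eq_C_mul, map_smul, hev a, smul_eq_mul, mul_comm]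
  refine ⟨⟨v, w, fun a => hmem _ (hv a), fun a => ?_, hexact⟩⟩
  have hb0 : Lagrange.basis Finset.univ v a ≠ 0 :=
    Lagrange.basis_ne_zero hinjOn (Finset.mem_univ a)
  have hbd : (Lagrange.basis Finset.univ v a).natDegree = k := by
    have := Lagrange.degree_basis hinjOn (Finset.mem_univ a)
    rw [Polynomial.degree_eq_natDegree hb0] at this
    have := WithBot.coe_injective this
    simpa using this
  have h1 := hexact (Lagrange.basis Finset.univ v a * Lagrange.basis Finset.univ v a)
    (by rw [Polynomial.natDegree_mul hb0 hb0]; omega)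
  rw [Finset.sum_eq_single a] at h1
  · rw [Polynomial.eval_mul, Lagrange.eval_basis_self hinjOn (Finset.mem_univ a), mul_one, mul_one]
      at h1
    rw [← h1]
    exact polyInt_pos (mul_ne_zero hb0 hb0) fun x _ => by
      simp only [Polynomial.eval_mul]; exact mul_self_nonneg _
  · intro c _ hca
    rw [Polynomial.eval_mul, Lagrange.eval_basis_of_ne hca.symm (Finset.mem_univ c)]; simp
  · simp

/-- A partition `0 = t_0 < t_1 < ⋯ < t_n = 1` of `(0, 1)` into intervals `J = (t_l, t_{l+1})` each of
which lies in a mesh cell and is mapped by `y` into a cell of the (periodically extended) mesh. -/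
structure RegularPartition (M : ℕ) (y : ℝ → ℝ) where
  n : ℕ
  node : ℕ → ℝ
  node_zero : node 0 = 0
  node_last : node n = 1
  node_lt : ∀ l < n, node l < node (l + 1)
  sub_cell : ∀ l < n, ∃ i : ℕ, i < M ∧
    Ioo (node l) (node (l + 1)) ⊆ Ioo ((i : ℝ) / M) (((i : ℝ) + 1) / M)
  image_sub_cell : ∀ l < n, ∃ j : ℤ,
    y '' Ioo (node l) (node (l + 1)) ⊆ Ioo ((j : ℝ) / M) (((j : ℝ) + 1) / M)

theorem exists_cell_of_no_crossing {M : ℕ} (hM : 1 ≤ M) {f : ℝ → ℝ} (hf : Continuous f) {a b : ℝ}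
    (hab : a < b) (hno : ∀ x ∈ Ioo a b, ∀ i : ℤ, f x ≠ (i : ℝ) / M) :
    ∃ j : ℤ, f '' Ioo a b ⊆ Ioo ((j : ℝ) / M) (((j : ℝ) + 1) / M) := by
  have hM0 : (0 : ℝ) < M := by exact_mod_cast hM
  have hm : (a + b) / 2 ∈ Ioo a b := ⟨by linarith, by linarith⟩
  have hconn : (f '' Ioo a b).OrdConnected :=
    (isPreconnected_Ioo.image f hf.continuousOn).ordConnected
  have hmf : f ((a + b) / 2) ∈ f '' Ioo a b := mem_image_of_mem f hm
  have h1 : ((⌊f ((a + b) / 2) * M⌋ : ℤ) : ℝ) / M ≤ f ((a + b) / 2) := by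
    rw [div_le_iff₀ hM0]; exact Int.floor_le _
  have h2 : f ((a + b) / 2) ≤ (((⌊f ((a + b) / 2) * M⌋ : ℤ) : ℝ) + 1) / M := by
    rw [le_div_iff₀ hM0]; exact (Int.lt_floor_add_one _).le
  refine ⟨⌊f ((a + b) / 2) * M⌋, fun z hz => ⟨?_, ?_⟩⟩
  · by_contra! hle
    obtain ⟨x, hx, hxe⟩ := hconn.out hz hmf ⟨hle, h1⟩
    exact hno x hx _ hxe
  · by_contra! hle
    obtain ⟨x, hx, hxe⟩ := hconn.out hmf hz ⟨h2, hle⟩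
    refine hno x hx (⌊f ((a + b) / 2) * M⌋ + 1) ?_
    rw [hxe]; push_cast; rfl

/-- An increasing continuous map has a regular partition. -/
theorem RegularPartition.nonempty {M : ℕ} (hM : 1 ≤ M) {y : ℝ → ℝ} (hy : Continuous y)
    (hmono : StrictMono y) : Nonempty (RegularPartition M y) := by
  have hM0 : (0 : ℝ) < M := by exact_mod_cast hM
  have hfin : ∀ f : ℝ → ℝ, StrictMono f → {x ∈ Icc (0 : ℝ) 1 | ∃ i : ℤ, f x = (i : ℝ) / M}.Finite := by
    intro f hf
    refine Set.Finite.of_finite_image (f := f) ?_ hf.injective.injOn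
    refine ((finite_Icc ⌊f 0 * M⌋ ⌈f 1 * M⌉).image fun i : ℤ => (i : ℝ) / M).subset ?_
    rintro _ ⟨x, ⟨hx, i, hi⟩, rfl⟩
    refine ⟨i, ⟨?_, ?_⟩, hi.symm⟩
    · have h := hf.monotone hx.1
      rw [hi, le_div_iff₀ hM0] at h
      exact_mod_cast (Int.floor_le (f 0 * M)).trans h
    · have h := hf.monotone hx.2
      rw [hi, div_le_iff₀ hM0] at h
      exact_mod_cast h.trans (Int.le_ceil (f 1 * M))
  have hS := (hfin id strictMono_id).union (hfin y hmono)
  obtain ⟨S, hSmem⟩ : ∃ S : Finset ℝ, ∀ x, x ∈ S ↔ x ∈ Icc (0 : ℝ) 1 ∧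
      ((∃ i : ℤ, x = (i : ℝ) / M) ∨ ∃ i : ℤ, y x = (i : ℝ) / M) :=
    ⟨hS.toFinset, fun x => by simp only [Finite.mem_toFinset, mem_union, mem_ofPred_eq, id]; tauto⟩
  have h0 : (0 : ℝ) ∈ S := (hSmem 0).2 ⟨by simp, Or.inl ⟨0, by simp⟩⟩
  have h1 : (1 : ℝ) ∈ S := (hSmem 1).2 ⟨by simp, Or.inl ⟨M, by field_simp; simp⟩⟩
  obtain ⟨n, hn⟩ : ∃ n, S.card = n + 1 :=
    Nat.exists_eq_succ_of_ne_zero (Finset.card_ne_zero_of_mem h0)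
  let e := S.orderEmbOfFin hn
  have heS : ∀ i, e i ∈ S := Finset.orderEmbOfFin_mem S hn
  have hsurj : ∀ x ∈ S, ∃ i, e i = x := fun x hx => by
    have : x ∈ Set.range e := by rw [Finset.range_orderEmbOfFin]; exact hx
    exact this
  let t : ℕ → ℝ := fun l => if h : l < n + 1 then e ⟨l, h⟩ else 1
  have ht : ∀ l (h : l < n + 1), t l = e ⟨l, h⟩ := fun l h => dif_pos h
  have hlt : ∀ l < n, t l < t (l + 1) := fun l hl => by
    rw [ht l (by omega), ht (l + 1) (by omega)]
    exact e.strictMono (Fin.mk_lt_mk.2 (Nat.lt_succ_self l))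
  have hmem01 : ∀ l < n, ∀ x ∈ Ioo (t l) (t (l + 1)), x ∈ Icc (0 : ℝ) 1 := fun l hl x hx => by
    rw [ht l (by omega), ht (l + 1) (by omega)] at hx
    exact ⟨((hSmem _).1 (heS ⟨l, by omega⟩)).1.1.trans hx.1.le,
      hx.2.le.trans ((hSmem _).1 (heS ⟨l + 1, by omega⟩)).1.2⟩
  have hno : ∀ l < n, ∀ x ∈ Ioo (t l) (t (l + 1)), x ∉ S := fun l hl x hx hxS => by
    rw [ht l (by omega), ht (l + 1) (by omega)] at hx
    obtain ⟨i, rfl⟩ := hsurj x hxS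
    have ha := e.lt_iff_lt.1 hx.1
    have hb := e.lt_iff_lt.1 hx.2
    rw [Fin.lt_def] at ha hb
    simp only at ha hb
    omega
  refine ⟨⟨n, t, ?_, ?_, hlt, fun l hl => ?_, fun l hl => ?_⟩⟩
  · obtain ⟨i, hi⟩ := hsurj 0 h0
    rw [ht 0 (by omega)]
    refine le_antisymm ?_ ((hSmem _).1 (heS _)).1.1
    rw [← hi]
    exact e.monotone (Fin.mk_le_of_le_val (Nat.zero_le _))
  · obtain ⟨i, hi⟩ := hsurj 1 h1
    rw [ht n (by omega)]
    refine le_antisymm ((hSmem _).1 (heS _)).1.2 ?_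
    rw [← hi]
    exact e.monotone (Fin.le_def.2 (Nat.lt_succ_iff.1 i.2))
  · obtain ⟨j, hj⟩ := exists_cell_of_no_crossing hM continuous_id (hlt l hl) fun x hx i hi =>
      hno l hl x hx ((hSmem x).2 ⟨hmem01 l hl x hx, Or.inl ⟨i, hi⟩⟩)
    rw [image_id] at hj
    have hm : (t l + t (l + 1)) / 2 ∈ Ioo (t l) (t (l + 1)) :=
      ⟨by linarith [hlt l hl], by linarith [hlt l hl]⟩
    have hc := hj hm
    have hI := hmem01 l hl _ hm
    have hj0 : 0 ≤ j := by
      have := hI.1.trans_lt hc.2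
      rw [lt_div_iff₀ hM0, zero_mul] at this
      have : (0 : ℤ) < j + 1 := by exact_mod_cast this
      omega
    have hjM : j < M := by
      have := hc.1.trans_le hI.2
      rw [div_lt_iff₀ hM0, one_mul] at this
      exact_mod_cast this
    lift j to ℕ using hj0
    exact ⟨j, by exact_mod_cast hjM, by simpa using hj⟩
  · exact exists_cell_of_no_crossing hM hy (hlt l hl) fun x hx i hi =>
      hno l hl x hx ((hSmem x).2 ⟨hmem01 l hl x hx, Or.inr ⟨i, hi⟩⟩)

/-- The bilinear product `(f, g)_G`: the Gauss rule applied to `f g` on every interval of the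
partition. -/
noncomputable def gaussProd {k M : ℕ} {y : ℝ → ℝ} (G : GaussRule k) (P : RegularPartition M y)
    (f g : ℝ → ℝ) : ℝ :=
  ∑ l ∈ Finset.range P.n, ∑ a : Fin (k + 1),
    G.weight a / 2 * (P.node (l + 1) - P.node l) *
      (f ((P.node l + P.node (l + 1)) / 2 + G.point a * ((P.node (l + 1) - P.node l) / 2)) *
        g ((P.node l + P.node (l + 1)) / 2 + G.point a * ((P.node (l + 1) - P.node l) / 2)))

/-- The Euler characteristic `γ^q_h(x) = x + b(x) h + q σ(x) √h`. -/
noncomputable def eulerMap (b σ : ℝ → ℝ) (h q x : ℝ) : ℝ :=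
  x + b x * h + q * σ x * Real.sqrt h

/-- Platen's second order characteristic `y^q_h(x)`. -/
noncomputable def platenMap (b σ : ℝ → ℝ) (h q x : ℝ) : ℝ :=
  x + 1 / 2 * (b (eulerMap b σ h (Real.sqrt 3 * q) x) + b x) * h
    + 1 / 4 * ((σ (eulerMap b σ h 1 x) + σ (eulerMap b σ h (-1) x) + 2 * σ x) * (Real.sqrt 3 * q)
        + (σ (eulerMap b σ h 1 x) - σ (eulerMap b σ h (-1) x)) * (3 * q ^ 2 - 1)) * Real.sqrt h

/-- The two schemes. -/
inductive Scheme
  | sldg1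
  | sldg2

namespace Scheme

/-- The number of characteristics used by the scheme. -/
def numPaths : Scheme → ℕ
  | sldg1 => 2
  | sldg2 => 3

/-- The values of the parameter `q`. -/
def shift : (s : Scheme) → Fin s.numPaths → ℝ
  | sldg1 => ![-1, 1]
  | sldg2 => ![-1, 0, 1]

/-- The weights `α_q`. -/
noncomputable def weight : (s : Scheme) → Fin s.numPaths → ℝ
  | sldg1 => ![1 / 2, 1 / 2]
  | sldg2 => ![1 / 6, 2 / 3, 1 / 6]

/-- The characteristics `y^q_h` of the scheme. -/
noncomputable def charMap (s : Scheme) (b σ : ℝ → ℝ) (h : ℝ) (j : Fin s.numPaths) : ℝ → ℝ :=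
  match s with
  | sldg1 => eulerMap b σ h (shift sldg1 j)
  | sldg2 => platenMap b σ h (shift sldg2 j)

/-- The smallness condition on the time step: `‖h b' + q √h σ'‖_∞ < 1` for `q = ± 1` for the first
scheme, and `h ‖b'‖_∞ + 3 √h ‖σ'‖_∞ < 1` for the second one. -/
def SmallStep (s : Scheme) (b σ : ℝ → ℝ) (h : ℝ) : Prop :=
  match s with
  | sldg1 => ∀ j, eLpNorm (fun x => h * deriv b x + shift sldg1 j * Real.sqrt h * deriv σ x) ⊤
      volume < 1
  | sldg2 => ENNReal.ofReal h * eLpNorm (deriv b) ⊤ volume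
      + 3 * ENNReal.ofReal (Real.sqrt h) * eLpNorm (deriv σ) ⊤ volume < 1

/-- `v = S_h u`, the scheme with exact integration: `v ∈ V_k` is the `L²` projection on `V_k` of
`∑_q α_q u(y^q_h(·))`. -/
def IsExactStep (s : Scheme) (b σ : ℝ → ℝ) (k M : ℕ) (h : ℝ) (u v : ℝ → ℝ) : Prop :=
  v ∈ dgSpace k M ∧ ∀ φ ∈ dgSpace k M,
    ∫ x in (0 : ℝ)..1, v x * φ x
      = ∫ x in (0 : ℝ)..1, (∑ j, s.weight j * u (s.charMap b σ h j x)) * φ x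

/-- `v = S̃_h u`, the fully discrete scheme: `v ∈ V_k` and
`(v, φ) = ∑_q α_q (u(y^q_h(·)), φ)_{G^q}` for all `φ ∈ V_k`. -/
def IsQuadStep (s : Scheme) (b σ : ℝ → ℝ) {k M : ℕ} (h : ℝ) (G : GaussRule k)
    (P : ∀ j, RegularPartition M (s.charMap b σ h j)) (u v : ℝ → ℝ) : Prop :=
  v ∈ dgSpace k M ∧ ∀ φ ∈ dgSpace k M,
    ∫ x in (0 : ℝ)..1, v x * φ x
      = ∑ j, s.weight j * gaussProd G (P j) (fun x => u (s.charMap b σ h j x)) φ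

end Scheme

/-! Energy argument. Testing a step with its own result `v` and using `2 u v ≤ u² + v²` gives `‖v‖²
≤ ∑ α_q ∫ u(y^q)²`, or the same bound with the Gauss sums of `u(y^q)²` on the right. The discrete
version works because the Gauss weights are positive and the rule is exact on products of two
elements of `V_k`, so that `(v, v)_G = ‖v‖²`. Existence and uniqueness are Riesz representation in a
finite-dimensional space.

Exact integration: every characteristic is `x + c_q √h σ(x)` up to a perturbation that is `O(h)` in
the sup and Lipschitz senses, with slope at least `c₀ > 0` (`IsCharacteristic`). The increment of
its inverse over an interval `(a, b]` is at most `(b - a)(1 + C h) - c_q √h (σ(b) - σ(a))`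
(`IsCharacteristic.increment_le`). Since `∑ α_q c_q = 0`, the terms of order `√h` cancel in the
average, and the averaged image of Lebesgue measure is at most `1 + C h` times Lebesgue measure
(`sum_integral_comp_le`). A single characteristic would only give `1 + C √h`.

Quadrature: on an interval of half length `l`, `u(y)²` is `P ∘ y` with `P ≥ 0` of degree at most
`2k`. After rescaling to `(-1, 1)` it is `Q ∘ τ` with `τ(t) = s t + e t² + O(h + √h l²)` and `e =
O(√h l)`. The polynomial `Q(s t) + Q'(s t) e t²` has degree at most `2k + 1`, so it is integrated
exactly and the error of order `√h l` disappears. What is left is `O(h + √h l²)` times bounds for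
`Q'` and `Q''`, which inverse inequalities and the slope bounds of `y` turn into a multiple of the
integral itself (`exists_gauss_comp_le`). For `k = 0` there is no quadrature error at all.

Under `Δx⁴ ≤ λ Δt` the term `√Δt Δx²` is at most `√λ Δt`, and the one-step bounds multiply to an
exponential. -/

/-! ### The space `V_k`: integrability, finite dimension, Riesz representation -/

/-- The discontinuous Galerkin space as a linear subspace. -/
def dgSubmodule (k M : ℕ) : Submodule ℝ (ℝ → ℝ) where
  carrier := dgSpace k M
  add_mem' := by
    rintro u v ⟨hu, hu'⟩ ⟨hv, hv'⟩
    refine ⟨hu.add hv, fun i hi => ?_⟩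
    obtain ⟨p, hp, hpu⟩ := hu' i hi
    obtain ⟨q, hq, hqv⟩ := hv' i hi
    exact ⟨p + q, (Polynomial.natDegree_add_le _ _).trans (max_le hp hq), fun x hx => by
      simp [hpu x hx, hqv x hx]⟩
  zero_mem' := ⟨fun _ => rfl, fun i _ => ⟨0, by simp, by simp⟩⟩
  smul_mem' := by
    rintro c u ⟨hu, hu'⟩
    refine ⟨fun x => by simp [hu x], fun i hi => ?_⟩
    obtain ⟨p, hp, hpu⟩ := hu' i hi
    exact ⟨c • p, (Polynomial.natDegree_smul_le _ _).trans hp, fun x hx => by simp [hpu x hx]⟩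

theorem mem_dgSubmodule {k M : ℕ} {u : ℝ → ℝ} : u ∈ dgSubmodule k M ↔ u ∈ dgSpace k M := Iff.rfl

/-- Every point of `[0, 1)` lies in a mesh cell. -/
theorem exists_cell {M : ℕ} (hM : 1 ≤ M) {x : ℝ} (hx : x ∈ Ico (0 : ℝ) 1) :
    ∃ i : ℕ, i < M ∧ x ∈ Ico ((i : ℝ) / M) (((i : ℝ) + 1) / M) := by
  have hM0 : (0 : ℝ) < M := by exact_mod_cast hM
  have h0 : 0 ≤ x * M := mul_nonneg hx.1 hM0.le
  refine ⟨⌊x * M⌋₊, (Nat.floor_lt h0).2 (by nlinarith [hx.2]), ?_, ?_⟩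
  · rw [div_le_iff₀ hM0]; exact Nat.floor_le h0
  · rw [lt_div_iff₀ hM0]; exact Nat.lt_floor_add_one _

theorem measurable_of_mem_dgSpace {k M : ℕ} (hM : 1 ≤ M) {u : ℝ → ℝ} (hu : u ∈ dgSpace k M) :
    Measurable u := by
  choose! p hp hpu using hu.2
  have key : u = (fun x => ∑ i ∈ Finset.range M,
      (Ico ((i : ℝ) / M) (((i : ℝ) + 1) / M)).indicator (fun x => (p i).eval x) x) ∘ Int.fract := by
    funext x
    have hM0 : (0 : ℝ) < M := by exact_mod_cast hM
    have hx : u x = u (Int.fract x) := by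
      have := hu.1.sub_int_mul_eq (x := x) ⌊x⌋
      rw [← this, mul_one]; rfl
    obtain ⟨i, hi, hix⟩ := exists_cell hM ⟨Int.fract_nonneg x, Int.fract_lt_one x⟩
    rw [hx, Function.comp_apply, Finset.sum_eq_single i, indicator_of_mem hix, hpu i hi _ hix]
    · intro j _ hji
      refine indicator_of_notMem (fun hj => hji ?_) _
      have h1 := (div_lt_div_iff_of_pos_right hM0).1 (hj.1.trans_lt hix.2)
      have h2 := (div_lt_div_iff_of_pos_right hM0).1 (hix.1.trans_lt hj.2)
      have h1' : j < i + 1 := by exact_mod_cast h1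
      have h2' : i < j + 1 := by exact_mod_cast h2
      omega
    · intro h; exact absurd (Finset.mem_range.2 hi) h
  rw [key]
  refine Measurable.comp ?_ measurable_fract
  exact Finset.measurable_sum _ fun i _ => (p i).continuous.measurable.indicator measurableSet_Ico

theorem bounded_of_mem_dgSpace {k M : ℕ} (hM : 1 ≤ M) {u : ℝ → ℝ} (hu : u ∈ dgSpace k M) :
    ∃ C, ∀ x, |u x| ≤ C := by
  choose! p hp hpu using hu.2
  have hb : ∀ i, ∃ C, ∀ x ∈ Icc (0 : ℝ) 1, ‖(p i).eval x‖ ≤ C := fun i =>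
    isCompact_Icc.exists_bound_of_continuousOn (p i).continuous.continuousOn
  choose C hC using hb
  refine ⟨∑ i ∈ Finset.range M, C i, fun x => ?_⟩
  obtain ⟨y, hy, hxy⟩ := hu.1.exists_mem_Ico₀ one_pos x
  obtain ⟨i, hi, hiy⟩ := exists_cell hM hy
  rw [hxy, hpu i hi y hiy]
  refine (hC i y ⟨hy.1, hy.2.le⟩).trans ?_
  exact Finset.single_le_sum (f := C) (fun j _ => (norm_nonneg _).trans (hC j 0 (by simp)))
    (Finset.mem_range.2 hi)

theorem intervalIntegrable_of_measurable_of_bounded {f : ℝ → ℝ} (hf : Measurable f)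
    (hb : ∃ C, ∀ x, |f x| ≤ C) (a b : ℝ) : IntervalIntegrable f volume a b := by
  obtain ⟨C, hC⟩ := hb
  refine (intervalIntegrable_const (c := C)).mono_fun hf.aestronglyMeasurable ?_
  refine Filter.Eventually.of_forall fun x => ?_
  simpa using (hC x).trans (le_abs_self C)

theorem bounded_mul {f g : ℝ → ℝ} (hf : ∃ C, ∀ x, |f x| ≤ C) (hg : ∃ C, ∀ x, |g x| ≤ C) :
    ∃ C, ∀ x, |f x * g x| ≤ C := by
  obtain ⟨C, hC⟩ := hf
  obtain ⟨D, hD⟩ := hg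
  exact ⟨C * D, fun x => by
    rw [abs_mul]
    exact mul_le_mul (hC x) (hD x) (abs_nonneg _) ((abs_nonneg _).trans (hC x))⟩

/-- An element of `V_k` whose square has integral zero vanishes. -/
theorem eq_zero_of_integral_sq_eq_zero {k M : ℕ} (hM : 1 ≤ M) {u : ℝ → ℝ} (hu : u ∈ dgSpace k M)
    (h : ∫ x in (0 : ℝ)..1, u x * u x = 0) : u = 0 := by
  have hM0 : (0 : ℝ) < M := by exact_mod_cast hM
  have hint := intervalIntegrable_of_measurable_of_bounded
    ((measurable_of_mem_dgSpace hM hu).mul (measurable_of_mem_dgSpace hM hu))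
    (bounded_mul (bounded_of_mem_dgSpace hM hu) (bounded_of_mem_dgSpace hM hu)) 0 1
  have hae : (fun x => u x * u x) =ᵐ[volume.restrict (Ioc (0 : ℝ) 1)] 0 :=
    (intervalIntegral.integral_eq_zero_iff_of_le_of_nonneg_ae zero_le_one
      (Filter.Eventually.of_forall fun x => mul_self_nonneg _) hint).1 h
  have hae' : ∀ᵐ x, x ∈ Ioc (0 : ℝ) 1 → u x = 0 := by
    filter_upwards [(ae_restrict_iff' measurableSet_Ioc).1 hae] with x hx hxm
    exact mul_self_eq_zero.1 (hx hxm)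
  funext x
  obtain ⟨y, hy, hxy⟩ := hu.1.exists_mem_Ico₀ one_pos x
  obtain ⟨i, hi, hiy⟩ := exists_cell hM hy
  obtain ⟨p, -, hpu⟩ := hu.2 i hi
  rw [hxy, hpu y hiy]
  suffices p = 0 by simp [this]
  refine Polynomial.eq_zero_of_infinite_isRoot p fun hfin => ?_
  have h1 : ∀ᵐ z ∂(volume : Measure ℝ), z ∉ {z | p.IsRoot z} :=
    measure_eq_zero_iff_ae_notMem.1 (hfin.measure_zero _)
  have hlt : (i : ℝ) / M < ((i : ℝ) + 1) / M := by gcongr; linarith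
  -- Almost every point of the open cell would be a zero of `u`, hence a root of `p`, but also
  -- outside the null set of roots; so the cell would be null, against its positive length.
  have h2 : volume (Ioo ((i : ℝ) / M) (((i : ℝ) + 1) / M)) = 0 := by
    refine measure_eq_zero_iff_ae_notMem.2 ?_
    filter_upwards [h1, hae'] with z hz1 hz2 hz
    refine hz1 ?_
    change p.eval z = 0
    rw [← hpu z (Ioo_subset_Ico_self hz)]
    refine hz2 ⟨lt_of_le_of_lt (by positivity) hz.1, hz.2.le.trans ?_⟩
    rw [div_le_one hM0]; exact_mod_cast hi
  rw [Real.volume_Ioo, ENNReal.ofReal_eq_zero] at h2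
  linarith

/-- A polynomial of degree at most `k` is determined by `k + 1` values, so evaluation at `k + 1`
equispaced points of each cell is injective. The points start at the left end of the half-open cell
and stop short of the right end. -/
theorem dgSubmodule_finite (k : ℕ) {M : ℕ} (hM : 1 ≤ M) : Module.Finite ℝ (dgSubmodule k M) := by
  have hM0 : (0 : ℝ) < M := by exact_mod_cast hM
  let pt : ℕ → ℕ → ℝ := fun i a => ((i : ℝ) + (a : ℝ) / (k + 1)) / M
  let T : dgSubmodule k M →ₗ[ℝ] (Fin M × Fin (k + 1) → ℝ) :=
    LinearMap.pi fun ia => (LinearMap.proj (pt ia.1 ia.2)) ∘ₗ (dgSubmodule k M).subtype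
  refine Module.Finite.of_injective T ((injective_iff_map_eq_zero T).2 fun u hT => ?_)
  have hu := u.2
  rw [mem_dgSubmodule] at hu
  refine Subtype.ext (funext fun x => ?_)
  obtain ⟨y, hy, hxy⟩ := hu.1.exists_mem_Ico₀ one_pos x
  obtain ⟨i, hi, hiy⟩ := exists_cell hM hy
  obtain ⟨p, hpk, hpu⟩ := hu.2 i hi
  rw [hxy, hpu y hiy]
  suffices p = 0 by simp [this]
  refine Polynomial.eq_zero_of_natDegree_lt_card_of_eval_eq_zero p
    (f := fun a : Fin (k + 1) => pt i a) ?_ (fun a => ?_) (by simpa using Nat.lt_succ_of_le hpk)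
  · intro a c hac
    have h1 : ((i : ℝ) + (a : ℝ) / (k + 1)) / M = ((i : ℝ) + (c : ℝ) / (k + 1)) / M := hac
    field_simp at h1
    have h2 : (a : ℝ) = c := by linarith
    exact Fin.ext (by exact_mod_cast h2)
  · have hmem : pt i a ∈ Ico ((i : ℝ) / M) (((i : ℝ) + 1) / M) := by
      have h1 : (a : ℝ) / (k + 1) < 1 := by
        rw [div_lt_one (by positivity)]; exact_mod_cast a.2
      have h0 : 0 ≤ (a : ℝ) / (k + 1) := by positivity
      exact ⟨div_le_div_of_nonneg_right (by linarith) hM0.le,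
        div_lt_div_of_pos_right (by linarith) hM0⟩
    rw [← hpu _ hmem]
    exact congrFun hT (⟨i, hi⟩, a)

/-- Riesz representation in `V_k` with the `L²` scalar product. -/
theorem existsUnique_dg_representative {k M : ℕ} (hM : 1 ≤ M) (F : (ℝ → ℝ) → ℝ)
    (hadd : ∀ φ ∈ dgSpace k M, ∀ ψ ∈ dgSpace k M, F (φ + ψ) = F φ + F ψ)
    (hsmul : ∀ (c : ℝ), ∀ φ ∈ dgSpace k M, F (c • φ) = c * F φ) :
    ∃! v, v ∈ dgSpace k M ∧ ∀ φ ∈ dgSpace k M, ∫ x in (0 : ℝ)..1, v x * φ x = F φ := by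
  have := dgSubmodule_finite k hM
  have hint : ∀ u v : dgSubmodule k M,
      IntervalIntegrable (fun x => (u : ℝ → ℝ) x * (v : ℝ → ℝ) x) volume 0 1 := fun u v =>
    intervalIntegrable_of_measurable_of_bounded
      ((measurable_of_mem_dgSpace hM u.2).mul (measurable_of_mem_dgSpace hM v.2))
      (bounded_mul (bounded_of_mem_dgSpace hM u.2) (bounded_of_mem_dgSpace hM v.2)) 0 1
  let B : dgSubmodule k M →ₗ[ℝ] Module.Dual ℝ (dgSubmodule k M) :=
    LinearMap.mk₂ ℝ (fun u v => ∫ x in (0 : ℝ)..1, (u : ℝ → ℝ) x * (v : ℝ → ℝ) x)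
      (fun u₁ u₂ v => by
        rw [← intervalIntegral.integral_add (hint u₁ v) (hint u₂ v)]
        simp [add_mul])
      (fun c u v => by
        rw [smul_eq_mul, ← intervalIntegral.integral_const_mul]
        simp [mul_assoc])
      (fun u v₁ v₂ => by
        rw [← intervalIntegral.integral_add (hint u v₁) (hint u v₂)]
        simp [mul_add])
      (fun c u v => by
        rw [smul_eq_mul, ← intervalIntegral.integral_const_mul]
        simp [mul_left_comm])
  have hB : ∀ u v, B u v = ∫ x in (0 : ℝ)..1, (u : ℝ → ℝ) x * (v : ℝ → ℝ) x := fun _ _ => rfl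
  have hinj : Function.Injective B := (injective_iff_map_eq_zero B).2 fun u hu =>
    Subtype.ext (eq_zero_of_integral_sq_eq_zero hM u.2 (by rw [← hB u u, hu]; rfl))
  -- Definiteness of the scalar product makes `B` injective into the dual; equality of dimensions
  -- makes it onto.
  have hsurj : Function.Surjective B :=
    (LinearMap.injective_iff_surjective_of_finrank_eq_finrank Subspace.dual_finrank_eq.symm).1 hinj
  let ℓ : Module.Dual ℝ (dgSubmodule k M) :=
    { toFun := fun φ => F φ
      map_add' := fun φ ψ => hadd φ φ.2 ψ ψ.2
      map_smul' := fun c φ => hsmul c φ φ.2 }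
  obtain ⟨v, hv⟩ := hsurj ℓ
  refine ⟨v, ⟨v.2, fun φ hφ => ?_⟩, fun w hw => ?_⟩
  · exact (hB v ⟨φ, hφ⟩).symm.trans (LinearMap.congr_fun hv ⟨φ, hφ⟩)
  · have : (⟨w, hw.1⟩ : dgSubmodule k M) = v := hinj (by
      rw [hv]
      exact LinearMap.ext fun φ => hw.2 φ φ.2)
    exact congrArg Subtype.val this

/-! ### Periodic functions, Taylor estimates and uniform bounds -/

theorem Function.Periodic.exists_abs_le_of_continuous {f : ℝ → ℝ} (hf : Function.Periodic f 1)
    (hc : Continuous f) : ∃ C, ∀ x, |f x| ≤ C := by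
  obtain ⟨C, hC⟩ := isCompact_Icc.exists_bound_of_continuousOn (s := Icc (0 : ℝ) 1) hc.continuousOn
  refine ⟨C, fun x => ?_⟩
  obtain ⟨y, hy, hxy⟩ := hf.exists_mem_Ico₀ one_pos x
  rw [hxy]
  exact hC y ⟨hy.1, hy.2.le⟩

theorem Function.Periodic.periodic_deriv {f : ℝ → ℝ} (hf : Function.Periodic f 1) :
    Function.Periodic (deriv f) 1 := fun x => by
  rw [← deriv_comp_add_const]
  exact congrArg (fun g => deriv g x) (funext hf)

/-- Mean value inequality around a point `m` at which the function vanishes. -/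
theorem abs_le_mul_of_abs_deriv_le {f f' : ℝ → ℝ} {m x C : ℝ} (hf : ∀ t, HasDerivAt f (f' t) t)
    (hm : f m = 0) (hC : ∀ t ∈ uIcc m x, |f' t| ≤ C) : |f x| ≤ C * |x - m| := by
  have := (convex_uIcc m x).norm_image_sub_le_of_norm_hasDerivWithin_le
    (fun t _ => (hf t).hasDerivWithinAt) hC left_mem_uIcc right_mem_uIcc
  rwa [hm, sub_zero] at this

theorem abs_sub_le_of_mem_uIcc {m x t : ℝ} (ht : t ∈ uIcc m x) : |t - m| ≤ |x - m| := by
  have := abs_sub_left_of_mem_uIcc ht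
  rwa [abs_sub_comm t m, abs_sub_comm x m, abs_sub_comm m t, abs_sub_comm m x]

/-- First order Taylor estimate. -/
theorem abs_taylor_one_le {f f' f'' : ℝ → ℝ} {m x C : ℝ} (hf : ∀ t, HasDerivAt f (f' t) t)
    (hf' : ∀ t, HasDerivAt f' (f'' t) t) (hC : ∀ t ∈ uIcc m x, |f'' t| ≤ C) :
    |f x - f m - f' m * (x - m)| ≤ C * |x - m| ^ 2 := by
  have hC0 : 0 ≤ C := (abs_nonneg _).trans (hC m left_mem_uIcc)
  have h1 : ∀ t ∈ uIcc m x, |f' t - f' m| ≤ C * |x - m| := fun t ht =>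
    (abs_le_mul_of_abs_deriv_le (f := fun t => f' t - f' m) (f' := f'') (m := m)
      (fun t => (hf' t).sub_const _) (sub_self _)
      (fun r hr => hC r (uIcc_subset_uIcc left_mem_uIcc ht hr))).trans
      (mul_le_mul_of_nonneg_left (abs_sub_le_of_mem_uIcc ht) hC0)
  have := abs_le_mul_of_abs_deriv_le (f := fun t => f t - f m - f' m * (t - m))
    (f' := fun t => f' t - f' m) (m := m) (x := x) (fun t => by
      convert! ((hf t).sub_const (f m)).sub (((hasDerivAt_id t).sub_const m).const_mul (f' m))
        using 1
      simp)
    (by simp) h1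
  calc _ ≤ _ := this
    _ = _ := by ring

/-- Second order Taylor estimate. -/
theorem abs_taylor_two_le {f f' f'' f''' : ℝ → ℝ} {m x C : ℝ} (hf : ∀ t, HasDerivAt f (f' t) t)
    (hf' : ∀ t, HasDerivAt f' (f'' t) t) (hf'' : ∀ t, HasDerivAt f'' (f''' t) t)
    (hC : ∀ t ∈ uIcc m x, |f''' t| ≤ C) :
    |f x - f m - f' m * (x - m) - f'' m / 2 * (x - m) ^ 2| ≤ C * |x - m| ^ 3 := by
  have hC0 : 0 ≤ C := (abs_nonneg _).trans (hC m left_mem_uIcc)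
  have h1 : ∀ t ∈ uIcc m x, |f' t - f' m - f'' m * (t - m)| ≤ C * |x - m| ^ 2 := fun t ht =>
    (abs_taylor_one_le hf' hf'' (fun r hr => hC r (uIcc_subset_uIcc left_mem_uIcc ht hr))).trans
      (mul_le_mul_of_nonneg_left
        (pow_le_pow_left₀ (abs_nonneg _) (abs_sub_le_of_mem_uIcc ht) 2) hC0)
  have := abs_le_mul_of_abs_deriv_le
    (f := fun t => f t - f m - f' m * (t - m) - f'' m / 2 * (t - m) ^ 2)
    (f' := fun t => f' t - f' m - f'' m * (t - m)) (m := m) (x := x) (fun t => by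
      have h2 := ((hasDerivAt_id t).sub_const m)
      have h3 := (((hf t).sub_const (f m)).sub (h2.const_mul (f' m))).sub
        ((h2.pow 2).const_mul (f'' m / 2))
      convert! h3 using 1
      simp; ring)
    (by simp) h1
  calc _ ≤ _ := this
    _ = _ := by ring

/-- Uniform bounds on `σ` and its derivatives; the third order Taylor estimate is only needed for
`k ≥ 1`. -/
structure SmoothBounds (σ : ℝ → ℝ) (k : ℕ) (K : ℝ) : Prop where
  differentiable : Differentiable ℝ σ
  bdd : ∀ x, |σ x| ≤ K
  deriv_bdd : ∀ x, |deriv σ x| ≤ K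
  deriv_deriv_bdd : ∀ x, |deriv (deriv σ) x| ≤ K
  lip : ∀ x y, |σ x - σ y| ≤ K * |x - y|
  deriv_lip : ∀ x y, |deriv σ x - deriv σ y| ≤ K * |x - y|
  taylor : k = 0 ∨ ∀ x m,
    |σ x - σ m - deriv σ m * (x - m) - deriv (deriv σ) m / 2 * (x - m) ^ 2| ≤ K * |x - m| ^ 3

theorem SmoothBounds.nonneg {σ : ℝ → ℝ} {k : ℕ} {K : ℝ} (h : SmoothBounds σ k K) : 0 ≤ K :=
  (abs_nonneg _).trans (h.bdd 0)

theorem abs_sub_le_of_abs_deriv_le {f : ℝ → ℝ} {C : ℝ} (hf : Differentiable ℝ f)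
    (hC : ∀ x, |deriv f x| ≤ C) (x y : ℝ) : |f x - f y| ≤ C * |x - y| :=
  convex_univ.norm_image_sub_le_of_norm_deriv_le (fun t _ => hf t) (fun t _ => hC t)
    (mem_univ y) (mem_univ x)

/-- Any larger `K` is admissible as well, so that one constant can later dominate the bounds for
`σ`, for `b` and for the drift of the Platen map. -/
theorem exists_smoothBounds {σ : ℝ → ℝ} {k : ℕ} (hper : Function.Periodic σ 1)
    (hσ : ContDiff ℝ ((2 * k + 2 : ℕ) : WithTop ℕ∞) σ) :
    ∃ K₀, ∀ K, K₀ ≤ K → SmoothBounds σ k K := by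
  have h2 : ContDiff ℝ ((1 + 1 : ℕ) : WithTop ℕ∞) σ := hσ.of_le (by exact_mod_cast (by omega))
  have h1 : ContDiff ℝ ((0 + 1 : ℕ) : WithTop ℕ∞) (deriv σ) := by
    have := (contDiff_succ_iff_deriv (n := 1)).1 (by exact_mod_cast h2)
    exact_mod_cast this.2.2
  have h0 : ContDiff ℝ 0 (deriv (deriv σ)) := by
    have := (contDiff_succ_iff_deriv (n := 0)).1 (by exact_mod_cast h1)
    exact_mod_cast this.2.2
  have hd : Differentiable ℝ σ := h2.differentiable (by simp)
  have hd1 : Differentiable ℝ (deriv σ) := h1.differentiable (by simp)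
  obtain ⟨C0, hC0⟩ := hper.exists_abs_le_of_continuous h2.continuous
  obtain ⟨C1, hC1⟩ := hper.periodic_deriv.exists_abs_le_of_continuous h1.continuous
  obtain ⟨C2, hC2⟩ := hper.periodic_deriv.periodic_deriv.exists_abs_le_of_continuous h0.continuous
  obtain ⟨C3, hC3⟩ : ∃ C3, k = 0 ∨ ∀ x m,
      |σ x - σ m - deriv σ m * (x - m) - deriv (deriv σ) m / 2 * (x - m) ^ 2|
        ≤ C3 * |x - m| ^ 3 := by
    rcases Nat.eq_zero_or_pos k with hk | hk
    · exact ⟨0, Or.inl hk⟩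
    have h3 : ContDiff ℝ ((2 + 1 : ℕ) : WithTop ℕ∞) σ := hσ.of_le (by exact_mod_cast (by omega))
    have h3' : ContDiff ℝ ((1 + 1 : ℕ) : WithTop ℕ∞) (deriv σ) := by
      have := (contDiff_succ_iff_deriv (n := 2)).1 (by exact_mod_cast h3)
      exact_mod_cast this.2.2
    have h3'' : ContDiff ℝ ((0 + 1 : ℕ) : WithTop ℕ∞) (deriv (deriv σ)) := by
      have := (contDiff_succ_iff_deriv (n := 1)).1 (by exact_mod_cast h3')
      exact_mod_cast this.2.2
    have h3''' : ContDiff ℝ 0 (deriv (deriv (deriv σ))) := by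
      have := (contDiff_succ_iff_deriv (n := 0)).1 (by exact_mod_cast h3'')
      exact_mod_cast this.2.2
    obtain ⟨C3, hC3⟩ := hper.periodic_deriv.periodic_deriv.periodic_deriv.exists_abs_le_of_continuous
      h3'''.continuous
    exact ⟨C3, Or.inr fun x m => abs_taylor_two_le (fun t => (hd t).hasDerivAt)
      (fun t => (hd1 t).hasDerivAt)
      (fun t => ((h3''.differentiable (by simp)) t).hasDerivAt) (fun t _ => hC3 t)⟩
  refine ⟨max (max C0 C1) (max C2 C3), fun K hK => ?_⟩
  have k0 : C0 ≤ K := ((le_max_left _ _).trans (le_max_left _ _)).trans hK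
  have k1 : C1 ≤ K := ((le_max_right _ _).trans (le_max_left _ _)).trans hK
  have k2 : C2 ≤ K := ((le_max_left _ _).trans (le_max_right _ _)).trans hK
  have k3 : C3 ≤ K := ((le_max_right _ _).trans (le_max_right _ _)).trans hK
  refine ⟨hd, fun x => (hC0 x).trans k0, fun x => (hC1 x).trans k1, fun x => (hC2 x).trans k2,
    abs_sub_le_of_abs_deriv_le hd fun x => (hC1 x).trans k1,
    abs_sub_le_of_abs_deriv_le hd1 fun x => (hC2 x).trans k2, ?_⟩
  exact hC3.imp id fun h x m => (h x m).trans (by gcongr)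

/-- If `g` is bounded by `ε` and `ε`-Lipschitz, then `σ(x + g(x)) - σ(x)` is Lipschitz with a
constant of order `ε`. -/
theorem SmoothBounds.abs_shift_sub_shift_le {σ : ℝ → ℝ} {k : ℕ} {K : ℝ} (hσ : SmoothBounds σ k K)
    {x y gx gy ε : ℝ} (hgy : |gy| ≤ ε) (hg : |gx - gy| ≤ ε * |x - y|) :
    |(σ (x + gx) - σ x) - (σ (y + gy) - σ y)| ≤ 2 * K * ε * |x - y| := by
  have hK := hσ.nonneg
  have h1 : |σ (x + gx) - σ (x + gy)| ≤ K * (ε * |x - y|) := by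
    refine (hσ.lip _ _).trans (mul_le_mul_of_nonneg_left ?_ hK)
    simpa using hg
  have h2 : |(σ (x + gy) - σ x) - (σ (y + gy) - σ y)| ≤ K * ε * |x - y| := by
    refine convex_univ.norm_image_sub_le_of_norm_hasDerivWithin_le
      (f := fun t => σ (t + gy) - σ t) (f' := fun t => deriv σ (t + gy) - deriv σ t)
      (fun t _ => ?_) (fun t _ => ?_) (mem_univ y) (mem_univ x)
    · exact (((hσ.differentiable _).hasDerivAt.comp_add_const t gy).sub
        (hσ.differentiable t).hasDerivAt).hasDerivWithinAt
    · refine (hσ.deriv_lip _ _).trans (mul_le_mul_of_nonneg_left ?_ hK)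
      simpa using hgy
  calc _ = |(σ (x + gx) - σ (x + gy)) + ((σ (x + gy) - σ x) - (σ (y + gy) - σ y))| := by ring_nf
    _ ≤ _ := abs_add_le _ _
    _ ≤ _ := by linarith

/-- A Lipschitz function is Lipschitz with constant `‖f'‖_∞`. -/
theorem LipschitzWith.abs_sub_le_of_eLpNorm_deriv_le {f : ℝ → ℝ} {C : NNReal}
    (hf : LipschitzWith C f) {B : ℝ} (hB0 : 0 ≤ B)
    (hB : eLpNorm (deriv f) ⊤ volume ≤ ENNReal.ofReal B) (x y : ℝ) :
    |f x - f y| ≤ B * |x - y| := by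
  have h1 : ∀ᵐ t, ‖deriv f t‖ ≤ B := by
    have := enorm_ae_le_eLpNormEssSup (deriv f) volume
    rw [eLpNorm_exponent_top] at hB
    filter_upwards [this] with t ht
    have := ht.trans hB
    rwa [← ofReal_norm, ENNReal.ofReal_le_ofReal_iff hB0] at this
  -- A Lipschitz function is absolutely continuous, hence the integral of its almost everywhere
  -- derivative.
  have h2 := (hf.lipschitzOnWith (s := uIcc y x)).absolutelyContinuousOnInterval.integral_deriv_eq_sub
  rw [← h2]
  exact intervalIntegral.norm_integral_le_of_norm_le_const_ae (h1.mono fun t ht _ => ht)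

/-! ### The characteristics as perturbations of `x + c √h σ(x)` -/

/-- The properties of a characteristic map used in the stability proof: it is
`x + c √h σ(x)` up to a Lipschitz perturbation of order `h`, uniformly increasing and commutes with
the translation by `1`. -/
structure IsCharacteristic (σ : ℝ → ℝ) (h c c₀ K : ℝ) (y : ℝ → ℝ) : Prop where
  lower : ∀ x₁ x₂, x₁ ≤ x₂ → c₀ * (x₂ - x₁) ≤ y x₂ - y x₁
  add_one : ∀ x, y (x + 1) = y x + 1
  drift_bdd : ∀ x, |y x - x - c * √h * σ x| ≤ K * h
  drift_lip : ∀ x₁ x₂, |(y x₁ - x₁ - c * √h * σ x₁) - (y x₂ - x₂ - c * √h * σ x₂)|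
    ≤ K * h * |x₁ - x₂|

theorem eulerMap_add_one {b σ : ℝ → ℝ} (hb : Function.Periodic b 1) (hσ : Function.Periodic σ 1)
    (h q x : ℝ) : eulerMap b σ h q (x + 1) = eulerMap b σ h q x + 1 := by
  simp only [eulerMap, hb x, hσ x]; ring

theorem platenMap_add_one {b σ : ℝ → ℝ} (hb : Function.Periodic b 1) (hσ : Function.Periodic σ 1)
    (h q x : ℝ) : platenMap b σ h q (x + 1) = platenMap b σ h q x + 1 := by
  simp only [platenMap, eulerMap_add_one hb hσ, hb x, hσ x, hb (eulerMap b σ h _ x),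
    hσ (eulerMap b σ h _ x)]
  ring

/-- The drift is exactly `h b`. With the two increments in separate absolute values, `hρ` covers
both signs of `q` at once. -/
theorem isCharacteristic_eulerMap {b σ : ℝ → ℝ} {h q ρ K : ℝ} (hb_per : Function.Periodic b 1)
    (hσ_per : Function.Periodic σ 1) (hh : 0 < h) (hq : |q| ≤ 1)
    (hbK : ∀ x, |b x| ≤ K) (hbL : ∀ x y, |b x - b y| ≤ K * |x - y|)
    (hρ : ∀ x y, |h * (b x - b y)| + |√h * (σ x - σ y)| ≤ ρ * |x - y|) :
    IsCharacteristic σ h q (1 - ρ) K (eulerMap b σ h q) where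
  lower x₁ x₂ hx := by
    have h1 := hρ x₂ x₁
    rw [abs_of_nonneg (sub_nonneg.2 hx)] at h1
    have h2 := neg_abs_le (h * (b x₂ - b x₁))
    have h3 : |q * (√h * (σ x₂ - σ x₁))| ≤ |√h * (σ x₂ - σ x₁)| := by
      rw [abs_mul]; exact mul_le_of_le_one_left (abs_nonneg _) hq
    have h4 := neg_abs_le (q * (√h * (σ x₂ - σ x₁)))
    simp only [eulerMap]
    linarith
  add_one := eulerMap_add_one hb_per hσ_per h q
  drift_bdd x := by
    have : eulerMap b σ h q x - x - q * √h * σ x = b x * h := by simp only [eulerMap]; ring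
    rw [this, abs_mul, abs_of_pos hh]
    exact mul_le_mul_of_nonneg_right (hbK x) hh.le
  drift_lip x₁ x₂ := by
    have : (eulerMap b σ h q x₁ - x₁ - q * √h * σ x₁) - (eulerMap b σ h q x₂ - x₂ - q * √h * σ x₂)
      = (b x₁ - b x₂) * h := by simp only [eulerMap]; ring
    rw [this, abs_mul, abs_of_pos hh]
    calc _ ≤ K * |x₁ - x₂| * h := mul_le_mul_of_nonneg_right (hbL x₁ x₂) hh.le
      _ = _ := by ring

/-- The slope of the Platen map with `q = ± 1`, from bounds on the increments of its ingredients. -/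
theorem platen_increment_lower {a s d w β₁ β₂ η η₁ η₂ : ℝ} (ha : 0 ≤ a) (hs : 0 ≤ s)
    (has : a + 3 * s ≤ 1) (hd : 0 ≤ d) (hw0 : 0 ≤ w) (hw : w ^ 2 = 3)
    (hβ₂ : |β₂| ≤ a * d) (hη : |η| ≤ s * d) (hβ₁ : |β₁| ≤ a * (d + β₂ + w * η))
    (hη₁ : |η₁| ≤ s * (d + β₂ + η)) (hη₂ : |η₂| ≤ s * (d + β₂ - η)) :
    1 / 4 * d ≤ d + 1 / 2 * (β₁ + β₂) + 1 / 4 * (η₁ * (w + 2) + η₂ * (w - 2) + 2 * w * η) := by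
  have hw1 : w ≤ 9 / 5 := by nlinarith
  have e1 := neg_le_of_abs_le hβ₁
  have e2 : -(s * (d + β₂ + η)) * (w + 2) ≤ η₁ * (w + 2) :=
    mul_le_mul_of_nonneg_right (neg_le_of_abs_le hη₁) (by linarith)
  -- Since `w = √3 < 2`, the factor `w - 2` is negative and it is the upper bound of `η₂` that
  -- enters.
  have e3 : s * (d + β₂ - η) * (w - 2) ≤ η₂ * (w - 2) :=
    mul_le_mul_of_nonpos_right (le_of_abs_le hη₂) (by linarith)
  -- After elimination of `β₁, η₁, η₂` the lower bound is affine in `β₂` and `η` with coefficients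
  -- `(1 - a)/2 - s` and `w (1 - a - s)/2`. Both are nonnegative, so the worst case is `β₂ = -a d`,
  -- `η = -s d`; `e6` is the resulting inequality in `a` and `s`.
  have e4 : 0 ≤ (1 / 2 * (1 - a) - s) * (β₂ + a * d) :=
    mul_nonneg (by linarith) (by linarith [neg_le_of_abs_le hβ₂])
  have e5 : 0 ≤ (w / 2 * (1 - a - s)) * (η + s * d) :=
    mul_nonneg (mul_nonneg (by linarith) (by linarith)) (by linarith [neg_le_of_abs_le hη])
  have e6 : 0 ≤ 3 / 4 - a / 2 - s - a * (1 - a) / 2 + a * s - w / 2 * (s * (1 - a - s)) := by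
    have h1 : w * (s * (1 - a - s)) ≤ 9 / 5 * (s * (1 - a - s)) :=
      mul_le_mul_of_nonneg_right hw1 (mul_nonneg hs (by linarith))
    nlinarith [mul_nonneg hs (by linarith : (0 : ℝ) ≤ 1 - a - 3 * s), sq_nonneg (1 - a),
      mul_nonneg (by linarith : (0 : ℝ) ≤ 1 - a) (by linarith : (0 : ℝ) ≤ 1 - a - 3 * s),
      mul_nonneg ha (by linarith : (0 : ℝ) ≤ 1 - a)]
  have e7 := mul_nonneg hd e6
  linarith

/-- The slope of the Platen map with `q = 0`. -/
theorem platen_zero_increment_lower {a s d β₁ β₂ η η₁ η₂ : ℝ} (hs : 0 ≤ s)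
    (has : a + 3 * s ≤ 1) (hd : 0 ≤ d)
    (hβ₂ : |β₂| ≤ a * d) (hβ₁ : |β₁| ≤ a * (d + β₂))
    (hη₁ : |η₁| ≤ s * (d + β₂ + η)) (hη₂ : |η₂| ≤ s * (d + β₂ - η)) :
    1 / 4 * d ≤ d + 1 / 2 * (β₁ + β₂) - 1 / 4 * (η₁ - η₂) := by
  have e1 := neg_le_of_abs_le hβ₁
  have e2 := le_of_abs_le hη₁
  have e3 := neg_le_of_abs_le hη₂
  -- Here `η` cancels between the bounds for `η₁` and `η₂`, and the worst case is `β₂ = -a d`.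
  have e4 : 0 ≤ (1 / 2 * (1 - a) - 1 / 2 * s) * (β₂ + a * d) :=
    mul_nonneg (by linarith) (by linarith [neg_le_of_abs_le hβ₂])
  have e6 : 0 ≤ 3 / 4 - a / 2 - s / 2 - a * (1 - a) / 2 + a * s / 2 := by
    nlinarith [mul_nonneg (by linarith : (0 : ℝ) ≤ 1 - a) (by linarith : (0 : ℝ) ≤ 1 - a - 3 * s),
      sq_nonneg (1 - a)]
  have e7 := mul_nonneg hd e6
  linarith

/-- The two algebraic lemmas apply with `a = h B` and `s = √h S`. The inner Euler maps with `|p| ≤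
2` are increasing under the step condition, so the absolute values of their increments are the
increments themselves, linear in those of `b` and `σ`. -/
theorem platenMap_lower {b σ : ℝ → ℝ} {h q B S : ℝ} (hh : 0 < h)
    (hq : q = -1 ∨ q = 0 ∨ q = 1) (hB : 0 ≤ B) (hS : 0 ≤ S)
    (hbL : ∀ x y, |b x - b y| ≤ B * |x - y|) (hσL : ∀ x y, |σ x - σ y| ≤ S * |x - y|)
    (hsmall : h * B + 3 * (√h * S) ≤ 1) {x₁ x₂ : ℝ} (hx : x₁ ≤ x₂) :
    1 / 4 * (x₂ - x₁) ≤ platenMap b σ h q x₂ - platenMap b σ h q x₁ := by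
  have hr : 0 ≤ √h := Real.sqrt_nonneg h
  have hd : 0 ≤ x₂ - x₁ := sub_nonneg.2 hx
  have hhB : 0 ≤ h * B := mul_nonneg hh.le hB
  have hrS : 0 ≤ √h * S := mul_nonneg hr hS
  have hw : √3 ^ 2 = 3 := Real.sq_sqrt (by norm_num)
  have hw0 : 0 ≤ √3 := Real.sqrt_nonneg 3
  have hw2 : √3 ≤ 2 := by nlinarith
  have hb' : ∀ x y, y ≤ x → |h * (b x - b y)| ≤ h * B * (x - y) := fun x y hxy => by
    rw [abs_mul, abs_of_pos hh, mul_assoc]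
    refine mul_le_mul_of_nonneg_left ?_ hh.le
    simpa [abs_of_nonneg (sub_nonneg.2 hxy)] using hbL x y
  have hσ' : ∀ x y, y ≤ x → |√h * (σ x - σ y)| ≤ √h * S * (x - y) := fun x y hxy => by
    rw [abs_mul, abs_of_nonneg hr, mul_assoc]
    refine mul_le_mul_of_nonneg_left ?_ hr
    simpa [abs_of_nonneg (sub_nonneg.2 hxy)] using hσL x y
  have hβ₂ := hb' x₂ x₁ hx
  have hη := hσ' x₂ x₁ hx
  have hγ : ∀ p, eulerMap b σ h p x₂ - eulerMap b σ h p x₁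
      = (x₂ - x₁) + h * (b x₂ - b x₁) + p * (√h * (σ x₂ - σ x₁)) := fun p => by
    simp only [eulerMap]; ring
  have hmono : ∀ p, |p| ≤ 2 → eulerMap b σ h p x₁ ≤ eulerMap b σ h p x₂ := fun p hp => by
    rw [← sub_nonneg, hγ p]
    have h1 := neg_le_of_abs_le hβ₂
    have h2 : |p * (√h * (σ x₂ - σ x₁))| ≤ 2 * (√h * S * (x₂ - x₁)) := by
      rw [abs_mul]; exact mul_le_mul hp hη (abs_nonneg _) (by norm_num)
    have h3 := neg_le_of_abs_le h2
    have h4 : 0 ≤ (1 - (h * B + 3 * (√h * S))) * (x₂ - x₁) := mul_nonneg (by linarith) hd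
    have h5 : 0 ≤ √h * S * (x₂ - x₁) := mul_nonneg hrS hd
    linarith
  have hη₁ := hσ' _ _ (hmono 1 (by norm_num))
  have hη₂ := hσ' _ _ (hmono (-1) (by norm_num))
  rw [hγ] at hη₁ hη₂
  rw [one_mul] at hη₁
  rw [neg_one_mul, ← sub_eq_add_neg] at hη₂
  rcases hq with rfl | rfl | rfl
  · have hβ₁ := hb' _ _ (hmono (√3 * -1) (by rw [abs_mul, abs_of_nonneg hw0]; simpa using hw2))
    rw [hγ] at hβ₁
    -- The case `q = -1` is the case `q = 1` with the sign of the `σ` increments reversed and the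
    -- two inner Euler maps exchanged.
    rw [← abs_neg] at hη hη₁ hη₂
    have := platen_increment_lower (η := -(√h * (σ x₂ - σ x₁))) hhB hrS hsmall hd hw0 hw hβ₂ hη
      (hβ₁.trans_eq (by ring)) (hη₂.trans_eq (by ring)) (hη₁.trans_eq (by ring))
    simp only [platenMap]
    linarith
  · have hβ₁ := hb' _ _ (hmono (√3 * 0) (by simp))
    rw [hγ] at hβ₁
    have := platen_zero_increment_lower hrS hsmall hd hβ₂ (hβ₁.trans_eq (by ring)) hη₁ hη₂
    simp only [platenMap]
    linarith
  · have hβ₁ := hb' _ _ (hmono (√3 * 1) (by rw [abs_mul, abs_of_nonneg hw0]; simpa using hw2))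
    rw [hγ] at hβ₁
    have := platen_increment_lower hhB hrS hsmall hd hw0 hw hβ₂ hη
      (hβ₁.trans_eq (by ring)) hη₁ hη₂
    simp only [platenMap]
    linarith

/-- Replacing the inner values `σ(γ^{±1})` by `σ(x)` turns the bracket into `4 √3 q σ(x)`, hence `c
= √3 q`. The replacement costs `O(√h)` in the sup and Lipschitz senses, and the outer `√h` makes it
`O(h)`. The Lipschitz part needs `σ'` Lipschitz; for `b` Lipschitz continuity is enough, because it
already carries the factor `h`. -/
theorem isCharacteristic_platenMap {b σ : ℝ → ℝ} {k : ℕ} {h h₀ q B S K : ℝ}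
    (hb_per : Function.Periodic b 1) (hσ_per : Function.Periodic σ 1) (hh : 0 < h) (hhh₀ : h ≤ h₀)
    (hq : q = -1 ∨ q = 0 ∨ q = 1) (hB : 0 ≤ B) (hS : 0 ≤ S)
    (hbB : ∀ x y, |b x - b y| ≤ B * |x - y|) (hσS : ∀ x y, |σ x - σ y| ≤ S * |x - y|)
    (hsmall : h * B + 3 * (√h * S) ≤ 1)
    (hbK : ∀ x, |b x| ≤ K) (hbL : ∀ x y, |b x - b y| ≤ K * |x - y|) (hσ : SmoothBounds σ k K) :
    IsCharacteristic σ h (√3 * q) (1 / 4)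
      (K * (1 + K * h₀ + K * √h₀) + 4 * K ^ 2 * (1 + √h₀)) (platenMap b σ h q) := by
  have hK := hσ.nonneg
  have hr : 0 ≤ √h := Real.sqrt_nonneg h
  have hr2 : √h * √h = h := Real.mul_self_sqrt hh.le
  have hrH : √h ≤ √h₀ := Real.sqrt_le_sqrt hhh₀
  have hw : √3 ^ 2 = 3 := Real.sq_sqrt (by norm_num)
  have hw0 : 0 ≤ √3 := Real.sqrt_nonneg 3
  have hw2 : √3 ≤ 2 := by nlinarith
  have hq1 : |√3 * q| ≤ 2 := by rcases hq with rfl | rfl | rfl <;> simp [abs_of_nonneg hw0, hw2]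
  have hq2 : |3 * q ^ 2 - 1| ≤ 2 := by rcases hq with rfl | rfl | rfl <;> norm_num
  -- A common bound for the size and the Lipschitz constant of the shift `g` when `|p| ≤ 1`, both
  -- being at most `K h + K √h`.
  set ε := √h * (K * (1 + √h₀)) with hε
  have hε0 : 0 ≤ ε := by positivity
  have hεe : √h * K * √h + K * √h ≤ ε := by
    rw [hε]; nlinarith [mul_nonneg hK hr, mul_le_mul_of_nonneg_left hrH (mul_nonneg hK hr)]
  let g : ℝ → ℝ → ℝ := fun p x => b x * h + p * σ x * √h
  have hγ : ∀ p x, eulerMap b σ h p x = x + g p x := fun p x => by simp only [eulerMap, g]; ring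
  have hgb : ∀ p, |p| ≤ 1 → ∀ x, |g p x| ≤ ε := fun p hp x => by
    refine le_trans ?_ hεe
    refine (abs_add_le _ _).trans (add_le_add ?_ ?_)
    · rw [abs_mul, abs_of_pos hh]
      calc _ ≤ K * h := mul_le_mul_of_nonneg_right (hbK x) hh.le
        _ = _ := by linear_combination -K * hr2
    · rw [abs_mul, abs_mul, abs_of_nonneg hr]
      refine mul_le_mul_of_nonneg_right ?_ hr
      exact (mul_le_of_le_one_left (abs_nonneg _) hp).trans (hσ.bdd x)
  have hgl : ∀ p, |p| ≤ 1 → ∀ x y, |g p x - g p y| ≤ ε * |x - y| := fun p hp x y => by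
    refine le_trans ?_ (mul_le_mul_of_nonneg_right hεe (abs_nonneg _))
    have : g p x - g p y = (b x - b y) * h + p * (σ x - σ y) * √h := by simp only [g]; ring
    rw [this, add_mul]
    refine (abs_add_le _ _).trans (add_le_add ?_ ?_)
    · rw [abs_mul, abs_of_pos hh]
      calc _ ≤ K * |x - y| * h := mul_le_mul_of_nonneg_right (hbL x y) hh.le
        _ = _ := by linear_combination -K * |x - y| * hr2
    · rw [abs_mul, abs_mul, abs_of_nonneg hr]
      calc _ ≤ K * |x - y| * √h := mul_le_mul_of_nonneg_right
            ((mul_le_of_le_one_left (abs_nonneg _) hp).trans (hσ.lip x y)) hr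
        _ = _ := by ring
  let D : ℝ → ℝ → ℝ := fun p x => σ (x + g p x) - σ x
  have hDb : ∀ p, |p| ≤ 1 → ∀ x, |D p x| ≤ K * ε := fun p hp x => by
    refine (hσ.lip _ _).trans (mul_le_mul_of_nonneg_left ?_ hK)
    simpa using hgb p hp x
  have hDl : ∀ p, |p| ≤ 1 → ∀ x y, |D p x - D p y| ≤ 2 * K * ε * |x - y| := fun p hp x y =>
    hσ.abs_shift_sub_shift_le (hgb p hp y) (hgl p hp x y)
  have h11 : |(1 : ℝ)| ≤ 1 := by norm_num
  have h1m : |(-1 : ℝ)| ≤ 1 := by norm_num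
  have hdrift : ∀ x, platenMap b σ h q x - x - √3 * q * √h * σ x
      = 1 / 2 * (b (eulerMap b σ h (√3 * q) x) + b x) * h
        + 1 / 4 * ((D 1 x + D (-1) x) * (√3 * q) + (D 1 x - D (-1) x) * (3 * q ^ 2 - 1)) * √h :=
    fun x => by simp only [platenMap, hγ, D]; ring
  have hεr : ε * √h = K * (1 + √h₀) * h := by
    rw [hε]; linear_combination K * (1 + √h₀) * hr2
  -- Used twice: with the values of `D` for the sup bound, and with their differences for the
  -- Lipschitz bound.
  have comb : ∀ u v E : ℝ, |u| ≤ E → |v| ≤ E →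
      |1 / 4 * ((u + v) * (√3 * q) + (u - v) * (3 * q ^ 2 - 1)) * √h| ≤ 2 * E * √h := by
    intro u v E hu hv
    rw [abs_mul, abs_of_nonneg hr]
    refine mul_le_mul_of_nonneg_right ?_ hr
    rw [abs_mul, abs_of_pos (by norm_num : (0 : ℝ) < 1 / 4)]
    have h1 : |(u + v) * (√3 * q)| ≤ (2 * E) * 2 := by
      rw [abs_mul]
      exact mul_le_mul ((abs_add_le _ _).trans (by linarith)) hq1 (abs_nonneg _)
        (by linarith [abs_nonneg u])
    have h2 : |(u - v) * (3 * q ^ 2 - 1)| ≤ (2 * E) * 2 := by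
      rw [abs_mul]
      exact mul_le_mul ((abs_sub _ _).trans (by linarith)) hq2 (abs_nonneg _)
        (by linarith [abs_nonneg u])
    have h3 := abs_add_le ((u + v) * (√3 * q)) ((u - v) * (3 * q ^ 2 - 1))
    linarith
  have hH := Real.sqrt_nonneg h₀
  have hh0 : 0 ≤ h₀ := hh.le.trans hhh₀
  refine ⟨fun x₁ x₂ hx => platenMap_lower hh hq hB hS hbB hσS hsmall hx,
    platenMap_add_one hb_per hσ_per h q, fun x => ?_, fun x₁ x₂ => ?_⟩
  · rw [hdrift]
    have h1 : |1 / 2 * (b (eulerMap b σ h (√3 * q) x) + b x) * h| ≤ K * h := by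
      rw [abs_mul, abs_of_pos hh, abs_mul, abs_of_pos (by norm_num : (0 : ℝ) < 1 / 2)]
      refine mul_le_mul_of_nonneg_right ?_ hh.le
      have := abs_add_le (b (eulerMap b σ h (√3 * q) x)) (b x)
      linarith [hbK (eulerMap b σ h (√3 * q) x), hbK x]
    have h2 := comb _ _ _ (hDb 1 h11 x) (hDb (-1) h1m x)
    have h3 : 2 * (K * ε) * √h = 2 * K ^ 2 * (1 + √h₀) * h := by
      rw [mul_assoc, mul_assoc, hεr]; ring
    have h4 : 0 ≤ (K * (K * h₀ + K * √h₀) + 2 * K ^ 2 * (1 + √h₀)) * h := by positivity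
    have := abs_add_le (1 / 2 * (b (eulerMap b σ h (√3 * q) x) + b x) * h)
      (1 / 4 * ((D 1 x + D (-1) x) * (√3 * q) + (D 1 x - D (-1) x) * (3 * q ^ 2 - 1)) * √h)
    linarith
  · rw [hdrift, hdrift]
    set γ := eulerMap b σ h (√3 * q) with hγd
    have hγl : |γ x₁ - γ x₂| ≤ (1 + K * h₀ + 2 * (K * √h₀)) * |x₁ - x₂| := by
      have e : γ x₁ - γ x₂ = (x₁ - x₂) + (b x₁ - b x₂) * h + √3 * q * ((σ x₁ - σ x₂) * √h) := by
        simp only [hγd, eulerMap]; ring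
      rw [e]
      have e1 : |(b x₁ - b x₂) * h| ≤ K * |x₁ - x₂| * h₀ := by
        rw [abs_mul, abs_of_pos hh]
        exact mul_le_mul (hbL _ _) hhh₀ hh.le (by positivity)
      have e2 : |√3 * q * ((σ x₁ - σ x₂) * √h)| ≤ 2 * (K * |x₁ - x₂| * √h₀) := by
        rw [abs_mul]
        refine mul_le_mul hq1 ?_ (abs_nonneg _) (by norm_num)
        rw [abs_mul, abs_of_nonneg hr]
        exact mul_le_mul (hσ.lip _ _) hrH hr (by positivity)
      have e3 := abs_add_le ((x₁ - x₂) + (b x₁ - b x₂) * h) (√3 * q * ((σ x₁ - σ x₂) * √h))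
      have e4 := abs_add_le (x₁ - x₂) ((b x₁ - b x₂) * h)
      linarith
    have h1 : |1 / 2 * ((b (γ x₁) - b (γ x₂)) + (b x₁ - b x₂)) * h|
        ≤ K * (1 + K * h₀ + K * √h₀) * h * |x₁ - x₂| := by
      rw [abs_mul, abs_of_pos hh, abs_mul, abs_of_pos (by norm_num : (0 : ℝ) < 1 / 2)]
      have e1 := (hbL (γ x₁) (γ x₂)).trans (mul_le_mul_of_nonneg_left hγl hK)
      have e2 := abs_add_le (b (γ x₁) - b (γ x₂)) (b x₁ - b x₂)
      have e3 := hbL x₁ x₂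
      have e5 : 0 ≤ K * (K * h₀) * |x₁ - x₂| := by positivity
      have e4 : 1 / 2 * |b (γ x₁) - b (γ x₂) + (b x₁ - b x₂)|
        ≤ K * (1 + K * h₀ + K * √h₀) * |x₁ - x₂| := by linarith
      calc _ ≤ _ := mul_le_mul_of_nonneg_right e4 hh.le
        _ = _ := by ring
    have h2 := comb _ _ _ (hDl 1 h11 x₁ x₂) (hDl (-1) h1m x₁ x₂)
    have h3 : 2 * (2 * K * ε * |x₁ - x₂|) * √h = 4 * K ^ 2 * (1 + √h₀) * h * |x₁ - x₂| := by
      calc _ = 4 * K * |x₁ - x₂| * (ε * √h) := by ring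
        _ = _ := by rw [hεr]; ring
    rw [h3] at h2
    calc _ = |1 / 2 * ((b (γ x₁) - b (γ x₂)) + (b x₁ - b x₂)) * h
          + 1 / 4 * ((D 1 x₁ - D 1 x₂ + (D (-1) x₁ - D (-1) x₂)) * (√3 * q)
            + (D 1 x₁ - D 1 x₂ - (D (-1) x₁ - D (-1) x₂)) * (3 * q ^ 2 - 1)) * √h| := by
          congr 1; ring
      _ ≤ _ := (abs_add_le _ _).trans (add_le_add h1 h2)
      _ = _ := by ring

/-! ### Uniform constants from the condition on the time step -/

theorem IsCharacteristic.mono {σ y : ℝ → ℝ} {h c c₀ K K' : ℝ} (hy : IsCharacteristic σ h c c₀ K y)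
    (hh : 0 ≤ h) (hK : K ≤ K') : IsCharacteristic σ h c c₀ K' y :=
  ⟨hy.lower, hy.add_one, fun x => (hy.drift_bdd x).trans (by gcongr),
    fun x₁ x₂ => (hy.drift_lip x₁ x₂).trans (by gcongr)⟩

/-- The larger of `|X + Y|` and `|X - Y|` is `|X| + |Y|`, so the conditions for `q = 1` and `q = -1`
together bound the sum of the absolute values. That sum is increasing in `h`, which carries the
bound from `h₀` to all smaller steps; the two separate conditions would not scale this way. -/
theorem exists_eulerMap_slope {b σ : ℝ → ℝ} {K : NNReal} (hb : LipschitzWith K b)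
    (hσ : Differentiable ℝ σ) {L : NNReal} (hσL : LipschitzWith L σ) {h₀ : ℝ} (hh₀ : 0 < h₀)
    (hsmall : Scheme.sldg1.SmallStep b σ h₀) :
    ∃ ρ < 1, ∀ h, 0 < h → h ≤ h₀ → ∀ x y,
      |h * (b x - b y)| + |√h * (σ x - σ y)| ≤ ρ * |x - y| := by
  have key : ∀ q : ℝ,
      eLpNorm (fun x => h₀ * deriv b x + q * √h₀ * deriv σ x) ⊤ volume < 1 →
      ∃ ρ, 0 ≤ ρ ∧ ρ < 1 ∧ ∀ x y, |h₀ * (b x - b y) + q * √h₀ * (σ x - σ y)| ≤ ρ * |x - y| := by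
    intro q hq
    have hne := (hq.trans ENNReal.one_lt_top).ne
    refine ⟨_, ENNReal.toReal_nonneg, (ENNReal.toReal_lt_toReal hne ENNReal.one_ne_top).2 hq,
      fun x y => ?_⟩
    have hf : LipschitzWith (‖h₀‖₊ * K + ‖q * √h₀‖₊ * L) (fun x => h₀ * b x + q * √h₀ * σ x) :=
      ((lipschitzWith_smul h₀).comp hb).add ((lipschitzWith_smul (q * √h₀)).comp hσL)
    have hae : deriv (fun x => h₀ * b x + q * √h₀ * σ x) =ᵐ[volume]
        fun x => h₀ * deriv b x + q * √h₀ * deriv σ x := by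
      filter_upwards [hb.ae_differentiableAt_real] with x hx
      exact ((hx.hasDerivAt.const_mul h₀).add ((hσ x).hasDerivAt.const_mul (q * √h₀))).deriv
    have := hf.abs_sub_le_of_eLpNorm_deriv_le ENNReal.toReal_nonneg
      (by rw [eLpNorm_congr_ae hae, ENNReal.ofReal_toReal hne]) x y
    calc _ = |h₀ * b x + q * √h₀ * σ x - (h₀ * b y + q * √h₀ * σ y)| := by congr 1; ring
      _ ≤ _ := this
  obtain ⟨ρ₀, hρ₀, hρ₀1, h0⟩ := key (-1) (hsmall (0 : Fin 2))
  obtain ⟨ρ₁, hρ₁, hρ₁1, h1⟩ := key 1 (hsmall (1 : Fin 2))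
  refine ⟨max ρ₀ ρ₁, max_lt hρ₀1 hρ₁1, fun h hh hhh x y => ?_⟩
  have hsum : |h₀ * (b x - b y)| + |√h₀ * (σ x - σ y)| ≤ max ρ₀ ρ₁ * |x - y| := by
    have e0 := (h0 x y).trans (mul_le_mul_of_nonneg_right (le_max_left ρ₀ ρ₁) (abs_nonneg _))
    have e1 := (h1 x y).trans (mul_le_mul_of_nonneg_right (le_max_right ρ₀ ρ₁) (abs_nonneg _))
    rw [abs_le] at e0 e1
    rcases abs_cases (h₀ * (b x - b y)) with h2 | h2 <;>
      rcases abs_cases (√h₀ * (σ x - σ y)) with h3 | h3 <;> linarith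
  refine le_trans ?_ hsum
  rw [abs_mul, abs_mul, abs_mul, abs_mul, abs_of_pos hh, abs_of_pos hh₀,
    abs_of_nonneg (Real.sqrt_nonneg _), abs_of_nonneg (Real.sqrt_nonneg _)]
  gcongr

theorem exists_platenMap_slope {b σ : ℝ → ℝ} {K : NNReal} (hb : LipschitzWith K b)
    {L : NNReal} (hσL : LipschitzWith L σ) {h₀ : ℝ} (hh₀ : 0 < h₀)
    (hsmall : Scheme.sldg2.SmallStep b σ h₀) :
    ∃ B S, 0 ≤ B ∧ 0 ≤ S ∧ (∀ x y, |b x - b y| ≤ B * |x - y|) ∧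
      (∀ x y, |σ x - σ y| ≤ S * |x - y|) ∧ h₀ * B + 3 * (√h₀ * S) ≤ 1 := by
  have hs : ENNReal.ofReal h₀ * eLpNorm (deriv b) ⊤ volume
      + 3 * ENNReal.ofReal (√h₀) * eLpNorm (deriv σ) ⊤ volume < 1 := hsmall
  -- An infinite norm times a positive factor would make the left side of the condition infinite.
  have hb_ne : eLpNorm (deriv b) ⊤ volume ≠ ⊤ := by
    intro h
    rw [h, ENNReal.mul_top (by simpa using hh₀)] at hs
    simp at hs
  have hσ_ne : eLpNorm (deriv σ) ⊤ volume ≠ ⊤ := by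
    intro h
    rw [h, ENNReal.mul_top (by simpa using hh₀)] at hs
    simp at hs
  refine ⟨_, _, ENNReal.toReal_nonneg, ENNReal.toReal_nonneg,
    hb.abs_sub_le_of_eLpNorm_deriv_le ENNReal.toReal_nonneg (ENNReal.ofReal_toReal hb_ne).ge,
    hσL.abs_sub_le_of_eLpNorm_deriv_le ENNReal.toReal_nonneg (ENNReal.ofReal_toReal hσ_ne).ge, ?_⟩
  have h1 := (ENNReal.toReal_lt_toReal (hs.trans ENNReal.one_lt_top).ne ENNReal.one_ne_top).2 hs
  rw [ENNReal.toReal_add (by finiteness) (by finiteness), ENNReal.toReal_mul, ENNReal.toReal_mul,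
    ENNReal.toReal_mul, ENNReal.toReal_ofReal hh₀.le, ENNReal.toReal_ofReal (Real.sqrt_nonneg _)]
    at h1
  rw [ENNReal.toReal_ofNat, ENNReal.toReal_one] at h1
  linarith

/-- All characteristics of both schemes satisfy `IsCharacteristic` uniformly for `0 < h ≤ h₀`. -/
theorem Scheme.exists_isCharacteristic (s : Scheme) {k : ℕ} {b σ : ℝ → ℝ}
    (hb_per : Function.Periodic b 1) (hσ_per : Function.Periodic σ 1)
    (hb : ∃ K, LipschitzWith K b) (hσ : ContDiff ℝ ((2 * k + 2 : ℕ) : WithTop ℕ∞) σ)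
    {h₀ : ℝ} (hh₀ : 0 < h₀) (hsmall : s.SmallStep b σ h₀) :
    ∃ (c : Fin s.numPaths → ℝ) (c₀ K : ℝ), 0 < c₀ ∧ SmoothBounds σ k K ∧ (∀ j, |c j| ≤ 2) ∧
      ∑ j, s.weight j * c j = 0 ∧
      ∀ h, 0 < h → h ≤ h₀ → ∀ j, IsCharacteristic σ h (c j) c₀ K (s.charMap b σ h j) := by
  obtain ⟨Kb, hKb⟩ := hb
  obtain ⟨Cb, hCb⟩ := hb_per.exists_abs_le_of_continuous hKb.continuous
  obtain ⟨K₀, hK₀⟩ := exists_smoothBounds hσ_per hσ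
  obtain ⟨K, hKK₀, hKKb, hKCb⟩ : ∃ K, K₀ ≤ K ∧ (Kb : ℝ) ≤ K ∧ Cb ≤ K :=
    ⟨max K₀ (max Kb Cb), le_max_left _ _, (le_max_left _ _).trans (le_max_right _ _),
      (le_max_right _ _).trans (le_max_right _ _)⟩
  have hσK := hK₀ K hKK₀
  have hK := hσK.nonneg
  have hbK : ∀ x, |b x| ≤ K := fun x => (hCb x).trans hKCb
  have hbL : ∀ x y, |b x - b y| ≤ K * |x - y| := fun x y =>
    (hKb.dist_le_mul x y).trans (mul_le_mul_of_nonneg_right hKKb dist_nonneg)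
  have hσL : LipschitzWith ⟨K, hK⟩ σ := LipschitzWith.of_dist_le_mul fun x y => hσK.lip x y
  cases s with
  | sldg1 =>
    obtain ⟨ρ, hρ, hslope⟩ := exists_eulerMap_slope hKb hσK.differentiable hσL hh₀ hsmall
    refine ⟨shift sldg1, 1 - ρ, K, by linarith, hσK, fun j => ?_, ?_, fun h hh hhh j => ?_⟩
    · change Fin 2 at j
      fin_cases j <;> simp [shift]
    · refine (Fin.sum_univ_two (M := ℝ) _).trans ?_
      simp [shift, weight]
    · refine isCharacteristic_eulerMap hb_per hσ_per hh ?_ hbK hbL (hslope h hh hhh)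
      change Fin 2 at j
      fin_cases j <;> simp [shift]
  | sldg2 =>
    obtain ⟨B, S, hB, hS, hbB, hσS, hBS⟩ := exists_platenMap_slope hKb hσL hh₀ hsmall
    have hw : √3 ≤ 2 := by
      have := Real.sq_sqrt (by norm_num : (0 : ℝ) ≤ 3)
      nlinarith [Real.sqrt_nonneg 3]
    refine ⟨fun j => √3 * shift sldg2 j, 1 / 4,
      max K (K * (1 + K * h₀ + K * √h₀) + 4 * K ^ 2 * (1 + √h₀)), by norm_num,
      hK₀ _ (hKK₀.trans (le_max_left _ _)), fun j => ?_, ?_, fun h hh hhh j => ?_⟩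
    · change Fin 3 at j
      fin_cases j <;> simp [shift, abs_of_nonneg (Real.sqrt_nonneg 3), hw]
    · refine (Fin.sum_univ_three (M := ℝ) _).trans ?_
      simp [shift, weight]
    · refine (isCharacteristic_platenMap hb_per hσ_per hh hhh ?_ hB hS hbB hσS ?_ hbK hbL hσK).mono
        hh.le (le_max_right _ _)
      · change Fin 3 at j
        fin_cases j <;> simp [shift]
      · refine le_trans ?_ hBS
        gcongr

/-! ### Transport of Lebesgue measure along characteristics -/

/-- A measure on `ℝ` that is at most `C` times Lebesgue measure on half-open intervals is so on all
sets. -/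
theorem measure_le_smul_volume_of_Ioc {ν : Measure ℝ} {C : NNReal}
    (h : ∀ a b, a ≤ b → ν (Ioc a b) ≤ C * ENNReal.ofReal (b - a)) : ν ≤ C • volume := by
  -- Lebesgue measure is built from an outer measure defined by coverings, which is the largest one
  -- dominated by the lengths; the comparison on intervals thus extends to all sets.
  rw [Real.volume_eq_stieltjes_id, ← StieltjesFunction.measure_smul]
  rw [Measure.le_iff']
  intro s
  have hle : ν.toOuterMeasure ≤ (C • StieltjesFunction.id).outer := by
    refine OuterMeasure.le_ofFunction.2 fun s => ?_
    rw [StieltjesFunction.length_eq]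
    refine le_iInf fun a => le_iInf fun b => le_iInf fun hs => ?_
    have hs' : s ⊆ Ioc a b := fun x hx => hs ⟨hx, not_isBot x⟩
    rcases le_or_gt a b with hab | hab
    · refine (measure_mono hs').trans ((h a b hab).trans_eq ?_)
      have : (C • StieltjesFunction.id) b - (C • StieltjesFunction.id) a = (C : ℝ) * (b - a) := by
        change (C : ℝ) * b - C * a = _; ring
      rw [this, ENNReal.ofReal_mul (NNReal.coe_nonneg C)]
      simp
    · rw [Ioc_eq_empty hab.not_gt] at hs'
      simp [subset_empty_iff.1 hs']
  have := hle s
  rw [StieltjesFunction.measure]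
  exact this

namespace IsCharacteristic

variable {σ y : ℝ → ℝ} {k : ℕ} {h h₀ c c₀ K : ℝ}

theorem abs_sub_le (hσ : SmoothBounds σ k K) (hc : |c| ≤ 2) (hh : 0 < h) (hhh : h ≤ h₀)
    (hy : IsCharacteristic σ h c c₀ K y) (x₁ x₂ : ℝ) :
    |y x₁ - y x₂| ≤ (1 + 2 * √h₀ * K + K * h₀) * |x₁ - x₂| := by
  have hK := hσ.nonneg
  have h1 : |c * √h * (σ x₁ - σ x₂)| ≤ 2 * √h₀ * (K * |x₁ - x₂|) := by
    rw [abs_mul, abs_mul, abs_of_nonneg (Real.sqrt_nonneg _)]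
    gcongr
    exact hσ.lip _ _
  have h2 : K * h * |x₁ - x₂| ≤ K * h₀ * |x₁ - x₂| := by gcongr
  have h3 := hy.drift_lip x₁ x₂
  have e : y x₁ - y x₂ = (x₁ - x₂) + c * √h * (σ x₁ - σ x₂)
      + ((y x₁ - x₁ - c * √h * σ x₁) - (y x₂ - x₂ - c * √h * σ x₂)) := by ring
  rw [e]
  have h4 := abs_add_le ((x₁ - x₂) + c * √h * (σ x₁ - σ x₂))
    ((y x₁ - x₁ - c * √h * σ x₁) - (y x₂ - x₂ - c * √h * σ x₂))
  have h5 := abs_add_le (x₁ - x₂) (c * √h * (σ x₁ - σ x₂))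
  linarith

theorem strictMono (hc₀ : 0 < c₀) (hy : IsCharacteristic σ h c c₀ K y) : StrictMono y :=
  fun x₁ x₂ hx => by
    have := hy.lower x₁ x₂ hx.le
    have := mul_pos hc₀ (sub_pos.2 hx)
    linarith

theorem continuous (hσ : SmoothBounds σ k K) (hc : |c| ≤ 2) (hh : 0 < h)
    (hy : IsCharacteristic σ h c c₀ K y) : Continuous y := by
  have hK := hσ.nonneg
  have h0 : 0 ≤ 1 + 2 * √h * K + K * h := by positivity
  exact (LipschitzWith.of_dist_le_mul (K := ⟨_, h0⟩)
    fun x₁ x₂ => hy.abs_sub_le hσ hc hh le_rfl x₁ x₂).continuous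

theorem surjective (hσ : SmoothBounds σ k K) (hc : |c| ≤ 2) (hh : 0 < h) (hc₀ : 0 < c₀)
    (hy : IsCharacteristic σ h c c₀ K y) : Function.Surjective y := by
  refine (hy.continuous hσ hc hh).surjective ?_ ?_
  · refine Filter.tendsto_atTop_mono' _ ?_ (Filter.tendsto_atTop_add_const_right _ (y 0)
      (Filter.tendsto_id.const_mul_atTop hc₀))
    filter_upwards [Filter.eventually_ge_atTop 0] with x hx
    have := hy.lower 0 x hx
    simp only [id]; linarith
  · refine Filter.tendsto_atBot_mono' _ ?_ (Filter.tendsto_atBot_add_const_right _ (y 0)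
      (Filter.tendsto_id.const_mul_atBot hc₀))
    filter_upwards [Filter.eventually_le_atBot 0] with x hx
    have := hy.lower x 0 hx
    simp only [id]; linarith

/-- A characteristic as an order isomorphism of the line. -/
noncomputable def orderIso (hσ : SmoothBounds σ k K) (hc : |c| ≤ 2) (hh : 0 < h) (hc₀ : 0 < c₀)
    (hy : IsCharacteristic σ h c c₀ K y) : ℝ ≃o ℝ :=
  (hy.strictMono hc₀).orderIsoOfSurjective y (hy.surjective hσ hc hh hc₀)

@[simp]
theorem coe_orderIso (hσ : SmoothBounds σ k K) (hc : |c| ≤ 2) (hh : 0 < h) (hc₀ : 0 < c₀)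
    (hy : IsCharacteristic σ h c c₀ K y) : ⇑(hy.orderIso hσ hc hh hc₀) = y := rfl

/-- The increments of the inverse of a characteristic. -/
theorem increment_le (hσ : SmoothBounds σ k K) (hc : |c| ≤ 2) (hh : 0 < h) (hhh : h ≤ h₀)
    (hc₀ : 0 < c₀) (hy : IsCharacteristic σ h c c₀ K y) {x₁ x₂ : ℝ} (hx : x₁ ≤ x₂) :
    x₂ - x₁ ≤ (y x₂ - y x₁)
        * (1 + (4 * K * (K * (2 + √h₀) * (1 + 1 / c₀)) + K / c₀) * h)
      - c * (√h * (σ (y x₂) - σ (y x₁))) := by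
  have hK := hσ.nonneg
  have hr : 0 ≤ √h := Real.sqrt_nonneg h
  have hr2 : √h * √h = h := Real.mul_self_sqrt hh.le
  have hrH : √h ≤ √h₀ := Real.sqrt_le_sqrt hhh
  have hH := Real.sqrt_nonneg h₀
  have hyx : 0 ≤ y x₂ - y x₁ := sub_nonneg.2 ((hy.strictMono hc₀).monotone hx)
  have hdx : x₂ - x₁ ≤ (y x₂ - y x₁) / c₀ := by
    rw [le_div_iff₀ hc₀, mul_comm]; exact hy.lower _ _ hx
  -- `ε` bounds `x - y(x)`, and also its Lipschitz constant as a function of `y(x)`; the summand `1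
  -- / c₀` pays for passing from increments of `x` to increments of `y`.
  set ε := √h * (K * (2 + √h₀) * (1 + 1 / c₀)) with hε
  have hA : √h * (2 * K) + K * h ≤ √h * (K * (2 + √h₀)) := by
    have : √h * √h * K ≤ √h * √h₀ * K := by gcongr
    rw [hr2] at this
    linarith
  have hA0 : 0 ≤ √h * (K * (2 + √h₀)) := by positivity
  have hg : |x₁ - y x₁| ≤ ε := by
    have h1 := hy.drift_bdd x₁
    have h2 : |c * √h * σ x₁| ≤ 2 * √h * K := by
      rw [abs_mul, abs_mul, abs_of_nonneg hr]
      gcongr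
      exact hσ.bdd _
    have e : x₁ - y x₁ = -((y x₁ - x₁ - c * √h * σ x₁) + c * √h * σ x₁) := by ring
    rw [e, abs_neg]
    have h3 := abs_add_le (y x₁ - x₁ - c * √h * σ x₁) (c * √h * σ x₁)
    have h4 : 0 ≤ √h * (K * (2 + √h₀)) * (1 / c₀) := by positivity
    rw [hε]; linarith
  have hd := hy.drift_lip x₂ x₁
  rw [abs_of_nonneg (sub_nonneg.2 hx)] at hd
  have hgl : |(x₂ - y x₂) - (x₁ - y x₁)| ≤ ε * |y x₂ - y x₁| := by
    rw [abs_of_nonneg hyx]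
    have h2 : |c * √h * (σ x₂ - σ x₁)| ≤ 2 * √h * (K * (x₂ - x₁)) := by
      rw [abs_mul, abs_mul, abs_of_nonneg hr]
      have := hσ.lip x₂ x₁
      rw [abs_of_nonneg (sub_nonneg.2 hx)] at this
      gcongr
    have e : (x₂ - y x₂) - (x₁ - y x₁)
        = -(((y x₂ - x₂ - c * √h * σ x₂) - (y x₁ - x₁ - c * √h * σ x₁))
          + c * √h * (σ x₂ - σ x₁)) := by ring
    rw [e, abs_neg]
    have h3 := abs_add_le ((y x₂ - x₂ - c * √h * σ x₂) - (y x₁ - x₁ - c * √h * σ x₁))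
      (c * √h * (σ x₂ - σ x₁))
    have h4 : (√h * (2 * K) + K * h) * (x₂ - x₁)
        ≤ √h * (K * (2 + √h₀)) * ((y x₂ - y x₁) / c₀) :=
      mul_le_mul hA hdx (sub_nonneg.2 hx) hA0
    have h5 : 0 ≤ √h * (K * (2 + √h₀)) * (y x₂ - y x₁) := mul_nonneg hA0 hyx
    have h6 : ε * (y x₂ - y x₁) = √h * (K * (2 + √h₀)) * (y x₂ - y x₁)
        + √h * (K * (2 + √h₀)) * ((y x₂ - y x₁) / c₀) := by rw [hε]; ring
    linarith
  -- In `x₂ - x₁ = Δy - c √h Δσ(x) - Δ(drift)` the values `σ(x_i)` are replaced by `σ(y(x_i))`. The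
  -- error `√h ε Δy` is of order `h`, and the remaining `√h` term depends on the characteristic only
  -- through `c`.
  have hs := hσ.abs_shift_sub_shift_le hg hgl
  rw [abs_of_nonneg hyx, add_sub_cancel, add_sub_cancel] at hs
  have h7 : |c * √h * ((σ x₂ - σ (y x₂)) - (σ x₁ - σ (y x₁)))|
      ≤ 2 * √h * (2 * K * ε * (y x₂ - y x₁)) := by
    rw [abs_mul, abs_mul, abs_of_nonneg hr]
    gcongr
  have h8 : 2 * √h * (2 * K * ε * (y x₂ - y x₁))
      = 4 * K * (K * (2 + √h₀) * (1 + 1 / c₀)) * h * (y x₂ - y x₁) := by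
    rw [hε]; linear_combination 4 * K * (K * (2 + √h₀) * (1 + 1 / c₀)) * (y x₂ - y x₁) * hr2
  have h9 : K * h * (x₂ - x₁) ≤ K * h * ((y x₂ - y x₁) / c₀) := by gcongr
  have h10 : K * h * ((y x₂ - y x₁) / c₀) = K / c₀ * h * (y x₂ - y x₁) := by ring
  have h11 := neg_le_of_abs_le h7
  have h12 := neg_le_of_abs_le hd
  linarith

theorem map_Ioc (hσ : SmoothBounds σ k K) (hc : |c| ≤ 2) (hh : 0 < h) (hc₀ : 0 < c₀)
    (hy : IsCharacteristic σ h c c₀ K y) (a b : ℝ) :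
    (volume.map y) (Ioc (y a) (y b)) = ENNReal.ofReal (b - a) := by
  rw [Measure.map_apply (hy.continuous hσ hc hh).measurable measurableSet_Ioc]
  have : y ⁻¹' Ioc (y a) (y b) = Ioc a b := by
    ext x
    simp [(hy.strictMono hc₀).lt_iff_lt, (hy.strictMono hc₀).le_iff_le]
  rw [this, Real.volume_Ioc]

/-- Lebesgue measure is at most a constant times its image under a characteristic. -/
theorem volume_le_map (hσ : SmoothBounds σ k K) (hc : |c| ≤ 2) (hh : 0 < h) (hhh : h ≤ h₀)
    (hc₀ : 0 < c₀) (hy : IsCharacteristic σ h c c₀ K y) :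
    volume ≤ (1 + 2 * √h₀ * K + K * h₀).toNNReal • volume.map y := by
  have hK := hσ.nonneg
  have hh0 : 0 ≤ h₀ := hh.le.trans hhh
  have hcont := hy.continuous hσ hc hh
  let e := hy.orderIso hσ hc hh hc₀
  have he : ∀ x, e x = y x := fun _ => rfl
  have hsm : Measurable e.symm := e.symm.continuous.measurable
  -- For the inverse map the preimage of `(a, b]` is `(y a, y b]`, whose length the Lipschitz bound
  -- controls. Pushing forward by `y` then gives the claim.
  have h1 : (volume.map e.symm) ≤ (1 + 2 * √h₀ * K + K * h₀).toNNReal • volume := by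
    refine measure_le_smul_volume_of_Ioc fun a b hab => ?_
    rw [Measure.map_apply hsm measurableSet_Ioc]
    have : e.symm ⁻¹' Ioc a b = Ioc (y a) (y b) := by
      ext x
      simp [← he]
    rw [this, Real.volume_Ioc]
    have h2 := (le_abs_self _).trans (hy.abs_sub_le hσ hc hh hhh b a)
    rw [abs_of_nonneg (sub_nonneg.2 hab)] at h2
    refine (ENNReal.ofReal_le_ofReal h2).trans_eq ?_
    rw [ENNReal.ofReal_mul (by positivity)]
    rfl
  have h2 := Measure.map_mono h1 hcont.measurable
  rw [Measure.map_map hcont.measurable hsm, Measure.map_smul] at h2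
  have h3 : y ∘ e.symm = id := funext fun x => by
    rw [Function.comp_apply, ← he, e.apply_symm_apply, id]
  rwa [h3, Measure.map_id] at h2

/-- `∫_{y(a)}^{y(b)} f ≤ Λ ∫_a^b f ∘ y`. -/
theorem integral_le_integral_comp (hσ : SmoothBounds σ k K) (hc : |c| ≤ 2) (hh : 0 < h)
    (hhh : h ≤ h₀) (hc₀ : 0 < c₀) (hy : IsCharacteristic σ h c c₀ K y) {f : ℝ → ℝ}
    (hf : Continuous f) (hf0 : ∀ x, 0 ≤ f x) {a b : ℝ} (hab : a ≤ b) :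
    ∫ x in (y a)..(y b), f x ≤ (1 + 2 * √h₀ * K + K * h₀) * ∫ x in a..b, f (y x) := by
  have hK := hσ.nonneg
  have hh0 : 0 ≤ h₀ := hh.le.trans hhh
  have hcont := hy.continuous hσ hc hh
  have hmono := hy.strictMono hc₀
  rw [intervalIntegral.integral_of_le (hmono.monotone hab), intervalIntegral.integral_of_le hab,
    ← integral_indicator measurableSet_Ioc, ← integral_indicator measurableSet_Ioc]
  have hcomp : ∀ x, (Ioc (y a) (y b)).indicator f (y x)
      = (Ioc a b).indicator (fun x => f (y x)) x := fun x => by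
    simp [indicator, hmono.lt_iff_lt, hmono.le_iff_le]
  have hsm : StronglyMeasurable ((Ioc (y a) (y b)).indicator f) :=
    hf.stronglyMeasurable.indicator measurableSet_Ioc
  have hint : Integrable ((Ioc a b).indicator (fun x => f (y x))) :=
    ((hf.comp hcont).integrableOn_Icc.mono_set Ioc_subset_Icc_self).integrable_indicator
      measurableSet_Ioc
  have hmap : ∫ x, (Ioc (y a) (y b)).indicator f x ∂(volume.map y)
      = ∫ x, (Ioc a b).indicator (fun x => f (y x)) x := by
    rw [integral_map hcont.aemeasurable hsm.aestronglyMeasurable]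
    simp only [hcomp]
  have hint' : Integrable ((Ioc (y a) (y b)).indicator f) (volume.map y) := by
    rw [integrable_map_measure hsm.aestronglyMeasurable hcont.aemeasurable]
    exact hint.congr (Filter.Eventually.of_forall fun x => (hcomp x).symm)
  refine (integral_mono_measure (hy.volume_le_map hσ hc hh hhh hc₀)
    (Filter.Eventually.of_forall fun x => indicator_nonneg (fun x _ => hf0 x) x)
    (hint'.smul_measure_nnreal)).trans_eq ?_
  rw [integral_smul_nnreal_measure, hmap, NNReal.smul_def, smul_eq_mul,
    Real.coe_toNNReal _ (by positivity)]

/-- The integral of a periodic function along a characteristic, in terms of the image measure. -/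
theorem integral_comp_eq (hσ : SmoothBounds σ k K) (hc : |c| ≤ 2) (hh : 0 < h)
    (hc₀ : 0 < c₀) (hy : IsCharacteristic σ h c c₀ K y) {f : ℝ → ℝ} (hf : Measurable f)
    (hper : Function.Periodic f 1) :
    ∫ x in (0 : ℝ)..1, f (y x) = ∫ x, (Ioc (0 : ℝ) 1).indicator f x ∂(volume.map y) := by
  have hcont := hy.continuous hσ hc hh
  have hmono := hy.strictMono hc₀
  -- The period `(a, a + 1]` is mapped exactly onto `(0, 1]`, and by periodicity it may replace the
  -- interval of integration.
  obtain ⟨a, ha⟩ := hy.surjective hσ hc hh hc₀ 0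
  have ha1 : y (a + 1) = 1 := by rw [hy.add_one, ha, zero_add]
  have hper' : Function.Periodic (fun x => f (y x)) 1 := fun x => by
    simp only [hy.add_one, hper (y x)]
  rw [integral_map hcont.aemeasurable (hf.indicator measurableSet_Ioc).aestronglyMeasurable]
  have hcomp : ∀ x, (Ioc (0 : ℝ) 1).indicator f (y x)
      = (Ioc a (a + 1)).indicator (fun x => f (y x)) x := fun x => by
    have h1 : 0 < y x ↔ a < x := by rw [← ha, hmono.lt_iff_lt]
    have h2 : y x ≤ 1 ↔ x ≤ a + 1 := by
      rw [← hmono.le_iff_le (b := a + 1), ha1]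
    simp [indicator, h1, h2]
  simp only [hcomp]
  rw [integral_indicator measurableSet_Ioc, ← intervalIntegral.integral_of_le (by linarith)]
  simpa using hper'.intervalIntegral_add_eq 0 a

end IsCharacteristic

/-- Averaging along the characteristics increases the integral of a nonnegative periodic function at
most by a factor `1 + C h`. -/
theorem sum_integral_comp_le {σ : ℝ → ℝ} {k : ℕ} {h h₀ c₀ K : ℝ} {ι : Type*} [Fintype ι]
    {α c : ι → ℝ} {y : ι → ℝ → ℝ} (hα : ∀ j, 0 ≤ α j) (hα1 : ∑ j, α j = 1)
    (hαc : ∑ j, α j * c j = 0) (hσ : SmoothBounds σ k K) (hc : ∀ j, |c j| ≤ 2) (hh : 0 < h)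
    (hhh : h ≤ h₀) (hc₀ : 0 < c₀) (hy : ∀ j, IsCharacteristic σ h (c j) c₀ K (y j)) {f : ℝ → ℝ}
    (hf : Measurable f) (hper : Function.Periodic f 1) (hf0 : ∀ x, 0 ≤ f x)
    (hfb : ∃ C, ∀ x, |f x| ≤ C) :
    ∑ j, α j * ∫ x in (0 : ℝ)..1, f (y j x)
      ≤ (1 + (4 * K * (K * (2 + √h₀) * (1 + 1 / c₀)) + K / c₀) * h) * ∫ x in (0 : ℝ)..1, f x := by
  have hK := hσ.nonneg
  set C := 1 + (4 * K * (K * (2 + √h₀) * (1 + 1 / c₀)) + K / c₀) * h with hC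
  have hC0 : 0 ≤ C := by positivity
  let ν : Measure ℝ := ∑ j, (α j).toNNReal • volume.map (y j)
  have hν : ν ≤ C.toNNReal • volume := by
    refine measure_le_smul_volume_of_Ioc fun a b hab => ?_
    have h1 : ∀ j, ((α j).toNNReal • volume.map (y j)) (Ioc a b)
        -- Nonnegativity is recorded as well: `ENNReal.ofReal` is additive only on nonnegative
        -- numbers, and the cancellation has to happen inside it.
        ≤ ENNReal.ofReal (α j * ((b - a) * C - c j * (√h * (σ b - σ a)))) ∧
        0 ≤ α j * ((b - a) * C - c j * (√h * (σ b - σ a))) := by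
      intro j
      obtain ⟨x₁, rfl⟩ := (hy j).surjective hσ (hc j) hh hc₀ a
      obtain ⟨x₂, rfl⟩ := (hy j).surjective hσ (hc j) hh hc₀ b
      have hx : x₁ ≤ x₂ := ((hy j).strictMono hc₀).le_iff_le.1 hab
      have hinc := (hy j).increment_le hσ (hc j) hh hhh hc₀ hx
      refine ⟨?_, mul_nonneg (hα j) ((sub_nonneg.2 hx).trans hinc)⟩
      rw [Measure.smul_apply, (hy j).map_Ioc hσ (hc j) hh hc₀, ENNReal.ofReal_mul (hα j)]
      exact mul_le_mul_right (ENNReal.ofReal_le_ofReal hinc) _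
    have h2 : ν (Ioc a b) = ∑ j, ((α j).toNNReal • volume.map (y j)) (Ioc a b) := by
      simp [ν]
    rw [h2]
    refine (Finset.sum_le_sum fun j _ => (h1 j).1).trans ?_
    rw [← ENNReal.ofReal_sum_of_nonneg fun j _ => (h1 j).2]
    -- The terms of order `√h` cancel by `∑ α_j c_j = 0`.
    have h3 : ∑ j, α j * ((b - a) * C - c j * (√h * (σ b - σ a))) = C * (b - a) := by
      calc _ = (∑ j, α j) * ((b - a) * C) - (∑ j, α j * c j) * (√h * (σ b - σ a)) := by
            rw [Finset.sum_mul, Finset.sum_mul, ← Finset.sum_sub_distrib]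
            exact Finset.sum_congr rfl fun j _ => by ring
        _ = _ := by rw [hα1, hαc]; ring
    rw [h3, ENNReal.ofReal_mul hC0]
    rfl
  have hFint : Integrable ((Ioc (0 : ℝ) 1).indicator f) volume :=
    ((intervalIntegrable_iff_integrableOn_Ioc_of_le zero_le_one).1
      (intervalIntegrable_of_measurable_of_bounded hf hfb 0 1)).integrable_indicator
      measurableSet_Ioc
  have hνint : Integrable ((Ioc (0 : ℝ) 1).indicator f) (C.toNNReal • volume) :=
    hFint.smul_measure_nnreal
  have hle := integral_mono_measure hν
    (Filter.Eventually.of_forall fun x => indicator_nonneg (fun x _ => hf0 x) x) hνint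
  have hsum : ∫ x, (Ioc (0 : ℝ) 1).indicator f x ∂ν
      = ∑ j, α j * ∫ x in (0 : ℝ)..1, f (y j x) := by
    rw [integral_finsetSum_measure (fun j _ => ?_)]
    · refine Finset.sum_congr rfl fun j _ => ?_
      rw [integral_smul_nnreal_measure, (hy j).integral_comp_eq hσ (hc j) hh hc₀ hf hper,
        NNReal.smul_def, smul_eq_mul, Real.coe_toNNReal _ (hα j)]
    · refine hνint.mono_measure (le_trans ?_ hν)
      exact Finset.single_le_sum (f := fun j => (α j).toNNReal • volume.map (y j))
        (fun j _ => Measure.zero_le _) (Finset.mem_univ j)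
  rw [hsum, integral_smul_nnreal_measure, integral_indicator measurableSet_Ioc,
    ← intervalIntegral.integral_of_le zero_le_one, NNReal.smul_def, smul_eq_mul,
    Real.coe_toNNReal _ hC0] at hle
  exact hle

/-! ### Inverse inequalities for polynomials -/

theorem Polynomial.eval_eq_sum_fin {Q : Polynomial ℝ} {n : ℕ} (hQ : Q.natDegree ≤ n) (x : ℝ) :
    Q.eval x = ∑ i : Fin (n + 1), Q.coeff i * x ^ (i : ℕ) := by
  rw [Q.eval_eq_sum_range' (Nat.lt_succ_of_le hQ), Finset.sum_range]

/-- The coefficients of a polynomial are controlled by its `L¹` norm on an interval. -/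
theorem exists_abs_coeff_le_integral (n : ℕ) {c : ℝ} (hc : 0 < c) :
    ∃ A, 0 ≤ A ∧ ∀ Q : Polynomial ℝ, Q.natDegree ≤ n → ∀ i,
      |Q.coeff i| ≤ A * ∫ x in (-c)..c, |Q.eval x| := by
  let f : (Fin (n + 1) → ℝ) → ℝ → ℝ := fun v x => |∑ i, v i * x ^ (i : ℕ)|
  let N : (Fin (n + 1) → ℝ) → ℝ := fun v => ∫ x in (-c)..c, f v x
  have hfc : Continuous (Function.uncurry f) := by
    simp only [f, Function.uncurry_def]; fun_prop
  have hN : Continuous N := intervalIntegral.continuous_parametric_intervalIntegral_of_continuous'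
    hfc _ _
  have hpoly : ∀ v : Fin (n + 1) → ℝ, v ≠ 0 → 0 < N v := by
    intro v hv
    let p : Polynomial ℝ := ∑ i : Fin (n + 1), Polynomial.monomial (i : ℕ) (v i)
    have hp : ∀ x, p.eval x = ∑ i, v i * x ^ (i : ℕ) := fun x => by
      simp [p, Polynomial.eval_finsetSum]
    have hp0 : p ≠ 0 := by
      intro h0
      refine hv (funext fun i => ?_)
      have := congrArg (fun q => Polynomial.coeff q (i : ℕ)) h0
      simpa [p, Polynomial.finsetSum_coeff, Polynomial.coeff_monomial, Fin.val_inj] using this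
    refine intervalIntegral.integral_pos (by linarith)
      (hfc.comp (Continuous.prodMk_right v)).continuousOn (fun x _ => abs_nonneg _) ?_
    by_contra! hcon
    refine hp0 (p.eq_zero_of_infinite_isRoot ((Icc_infinite (by linarith : -c < c)).mono ?_))
    intro x hx
    have := hcon x hx
    simp only [f, ← hp] at this
    exact abs_nonpos_iff.1 this
  -- The `L¹` norm is continuous and positive on the compact unit sphere of coefficient vectors; by
  -- homogeneity its minimum there gives the constant.
  obtain ⟨v₀, hv₀, hmin⟩ := (isCompact_sphere (0 : Fin (n + 1) → ℝ) 1).exists_isMinOn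
    (NormedSpace.sphere_nonempty.2 zero_le_one) hN.continuousOn
  have hδ : 0 < N v₀ := hpoly v₀ (by
    rintro rfl
    simp at hv₀)
  refine ⟨(N v₀)⁻¹, (inv_pos.2 hδ).le, fun Q hQ i => ?_⟩
  set v : Fin (n + 1) → ℝ := fun i => Q.coeff i with hvdef
  have hNv : ∫ x in (-c)..c, |Q.eval x| = N v := by
    simp only [N, f, Polynomial.eval_eq_sum_fin hQ, hvdef]
  have hNv0 : 0 ≤ N v := intervalIntegral.integral_nonneg (by linarith) fun x _ => abs_nonneg _
  have hv : ‖v‖ ≤ (N v₀)⁻¹ * N v := by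
    rcases eq_or_ne v 0 with h0 | h0
    · rw [h0, norm_zero, ← h0]; exact mul_nonneg (inv_pos.2 hδ).le hNv0
    · have hpos : 0 < ‖v‖ := norm_pos_iff.2 h0
      have hle : N v₀ ≤ N (‖v‖⁻¹ • v) := hmin (by simp [norm_smul, hpos.ne'])
      have hsmul : N (‖v‖⁻¹ • v) = ‖v‖⁻¹ * N v := by
        simp only [N, f]
        rw [← intervalIntegral.integral_const_mul]
        refine intervalIntegral.integral_congr fun x _ => ?_
        simp only [Pi.smul_apply, smul_eq_mul, mul_assoc, ← Finset.mul_sum]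
        rw [abs_mul, abs_of_pos (inv_pos.2 hpos)]
      rw [hsmul] at hle
      rw [inv_mul_eq_div, le_div_iff₀ hδ]
      calc _ ≤ ‖v‖ * (‖v‖⁻¹ * N v) := by gcongr
        _ = _ := by field_simp
  rw [hNv]
  rcases le_or_gt i n with hi | hi
  · exact (norm_le_pi_norm v ⟨i, Nat.lt_succ_of_le hi⟩).trans hv
  · rw [Polynomial.coeff_eq_zero_of_natDegree_lt (hQ.trans_lt hi), abs_zero]
    exact (norm_nonneg v).trans hv

theorem Polynomial.abs_eval_le_of_abs_coeff_le {Q : Polynomial ℝ} {n : ℕ} {B S x : ℝ}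
    (hQ : Q.natDegree ≤ n) (hB : ∀ i, |Q.coeff i| ≤ B) (hx : |x| ≤ S) :
    |Q.eval x| ≤ (n + 1) * (1 + S) ^ n * B := by
  have hS : 0 ≤ S := (abs_nonneg _).trans hx
  have hB0 : 0 ≤ B := (abs_nonneg _).trans (hB 0)
  rw [Polynomial.eval_eq_sum_fin hQ]
  refine (Finset.abs_sum_le_sum_abs _ _).trans ?_
  have h1 : ∀ i : Fin (n + 1), |Q.coeff i * x ^ (i : ℕ)| ≤ (1 + S) ^ n * B := fun i => by
    rw [abs_mul, abs_pow, mul_comm]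
    refine mul_le_mul ?_ (hB i) (abs_nonneg _) (by positivity)
    calc |x| ^ (i : ℕ) ≤ (1 + S) ^ (i : ℕ) := by gcongr; linarith
      _ ≤ (1 + S) ^ n := pow_le_pow_right₀ (by linarith) (Nat.lt_succ_iff.1 i.2)
  refine (Finset.sum_le_sum fun i _ => h1 i).trans_eq ?_
  simp; ring

theorem Polynomial.abs_coeff_derivative_le {Q : Polynomial ℝ} {n : ℕ} {B : ℝ}
    (hQ : Q.natDegree ≤ n) (hB : ∀ i, |Q.coeff i| ≤ B) (i : ℕ) :
    |Q.derivative.coeff i| ≤ n * B := by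
  have hB0 : 0 ≤ B := (abs_nonneg _).trans (hB 0)
  rw [Polynomial.coeff_derivative]
  rcases le_or_gt (i + 1) n with hi | hi
  · rw [abs_mul, mul_comm]
    refine mul_le_mul ?_ (hB _) (abs_nonneg _) (by positivity)
    rw [abs_of_nonneg (by positivity)]
    exact_mod_cast hi
  · rw [Polynomial.coeff_eq_zero_of_natDegree_lt (hQ.trans_lt hi), zero_mul, abs_zero]
    positivity

/-- Inverse inequalities: a polynomial of degree at most `n` and its first two derivatives are
controlled on `[-S, S]` by the `L¹` norm on `[-c, c]`. -/
theorem exists_inverse_inequality (n : ℕ) {c : ℝ} (hc : 0 < c) {S : ℝ} (hS : 0 ≤ S) :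
    ∃ A, 0 ≤ A ∧ ∀ Q : Polynomial ℝ, Q.natDegree ≤ n → ∀ x, |x| ≤ S →
      |Q.derivative.eval x| ≤ A * (∫ x in (-c)..c, |Q.eval x|) ∧
      |Q.derivative.derivative.eval x| ≤ A * ∫ x in (-c)..c, |Q.eval x| := by
  obtain ⟨A, hA, hcoeff⟩ := exists_abs_coeff_le_integral n hc
  refine ⟨(n + 1) * (1 + S) ^ n * ((n + n * n) * A), by positivity, fun Q hQ x hx => ?_⟩
  have hI : 0 ≤ ∫ x in (-c)..c, |Q.eval x| :=
    intervalIntegral.integral_nonneg (by linarith) fun x _ => abs_nonneg _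
  have hd1 : Q.derivative.natDegree ≤ n := (Q.natDegree_derivative_le.trans (Nat.sub_le _ _)).trans hQ
  have hd2 : Q.derivative.derivative.natDegree ≤ n :=
    (Q.derivative.natDegree_derivative_le.trans (Nat.sub_le _ _)).trans hd1
  have h1 := Polynomial.abs_coeff_derivative_le hQ (hcoeff Q hQ)
  have h2 := Polynomial.abs_coeff_derivative_le hd1 h1
  constructor
  · refine (Polynomial.abs_eval_le_of_abs_coeff_le hd1 h1 hx).trans ?_
    rw [mul_assoc _ ((_ : ℝ) * A)]
    gcongr ?_ * ?_
    have : 0 ≤ (n : ℝ) * n * (A * ∫ x in (-c)..c, |Q.eval x|) := by positivity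
    linarith
  · refine (Polynomial.abs_eval_le_of_abs_coeff_le hd2 h2 hx).trans ?_
    rw [mul_assoc _ ((_ : ℝ) * A)]
    gcongr ?_ * ?_
    have : 0 ≤ (n : ℝ) * (A * ∫ x in (-c)..c, |Q.eval x|) := by positivity
    linarith

/-! ### Gauss quadrature along a nearly affine map -/

namespace GaussRule

variable {k : ℕ} (G : GaussRule k)

theorem sum_weight : ∑ a, G.weight a = 2 := by
  have := G.exact 1 (by simp)
  simp at this
  linarith

theorem point_mem_Icc (a : Fin (k + 1)) : G.point a ∈ Icc (-1 : ℝ) 1 :=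
  Ioo_subset_Icc_self (G.point_mem a)

/-- A function that is uniformly close to a polynomial of degree `2 k + 1` is integrated almost
exactly. -/
theorem sum_le_integral_add {f : ℝ → ℝ} (hf : Continuous f) {T : Polynomial ℝ}
    (hT : T.natDegree ≤ 2 * k + 1) {δ : ℝ} (h : ∀ t ∈ Icc (-1 : ℝ) 1, |f t - T.eval t| ≤ δ) :
    ∑ a, G.weight a * f (G.point a) ≤ (∫ t in (-1 : ℝ)..1, f t) + 4 * δ := by
  -- Of the error `4 δ`, half comes from the rule (its weights sum to `2`) and half from the
  -- integral over an interval of length `2`.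
  have h1 : ∑ a, G.weight a * f (G.point a)
      ≤ ∑ a, G.weight a * (T.eval (G.point a)) + 2 * δ := by
    rw [← G.sum_weight, Finset.sum_mul, ← Finset.sum_add_distrib]
    refine Finset.sum_le_sum fun a _ => ?_
    have := le_of_abs_le (h _ (G.point_mem_Icc a))
    rw [← mul_add]
    exact mul_le_mul_of_nonneg_left (by linarith) (G.weight_pos a).le
  have h2 : ∫ t in (-1 : ℝ)..1, T.eval t ≤ (∫ t in (-1 : ℝ)..1, f t) + 2 * δ := by
    have : ∫ t in (-1 : ℝ)..1, (f t + δ) = (∫ t in (-1 : ℝ)..1, f t) + 2 * δ := by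
      rw [intervalIntegral.integral_add (hf.intervalIntegrable _ _) intervalIntegrable_const,
        intervalIntegral.integral_const, smul_eq_mul]
      ring
    rw [← this]
    refine intervalIntegral.integral_mono_on (by norm_num) (T.continuous.intervalIntegrable _ _)
      ((hf.add continuous_const).intervalIntegrable _ _) fun t ht => ?_
    have := neg_le_of_abs_le (h t ht)
    linarith
  rw [G.exact T hT] at h2
  linarith

/-- Quadrature of `Q ∘ τ` for a polynomial `Q` of degree `2 k` and a map `τ` that is nearly affine;
the quadratic part of `τ` does not contribute to the error at first order. -/
theorem sum_comp_le_integral_comp_add (hk : 1 ≤ k) {Q : Polynomial ℝ} (hQ : Q.natDegree ≤ 2 * k)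
    {τ : ℝ → ℝ} (hτ : Continuous τ) {S s e δ δ' N : ℝ}
    (hτS : ∀ t ∈ Icc (-1 : ℝ) 1, |τ t| ≤ S) (hsS : |s| ≤ S)
    (hδ : ∀ t ∈ Icc (-1 : ℝ) 1, |τ t - s * t - e * t ^ 2| ≤ δ)
    (hδ' : ∀ t ∈ Icc (-1 : ℝ) 1, |τ t - s * t| ≤ δ')
    (hN : ∀ x, |x| ≤ S → |Q.derivative.eval x| ≤ N ∧ |Q.derivative.derivative.eval x| ≤ N) :
    ∑ a, G.weight a * Q.eval (τ (G.point a))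
      ≤ (∫ t in (-1 : ℝ)..1, Q.eval (τ t)) + 4 * (N * (δ + δ' ^ 2)) := by
  have hS0 : 0 ≤ S := (abs_nonneg _).trans hsS
  have hN0 : 0 ≤ N := (abs_nonneg _).trans (hN 0 (by simpa using hS0)).1
  let ℓ : Polynomial ℝ := Polynomial.C s * Polynomial.X
  -- First order expansion of `Q(τ)` at `s t`, keeping the quadratic part of `τ`. As `k ≥ 1`, the
  -- second summand has degree at most `(2k - 1) + 2 = 2k + 1`, just within the exactness of the
  -- rule.
  let T : Polynomial ℝ := Q.comp ℓ + Q.derivative.comp ℓ * (Polynomial.C e * Polynomial.X ^ 2)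
  have hℓ : ℓ.natDegree ≤ 1 := (Polynomial.natDegree_C_mul_le _ _).trans Polynomial.natDegree_X_le
  have hcomp : ∀ p : Polynomial ℝ, ∀ n, p.natDegree ≤ n → (p.comp ℓ).natDegree ≤ n := fun p n hp => by
    refine Polynomial.natDegree_comp_le.trans ?_
    calc _ ≤ n * 1 := Nat.mul_le_mul hp hℓ
      _ = n := mul_one n
  have hTd : T.natDegree ≤ 2 * k + 1 := by
    refine (Polynomial.natDegree_add_le _ _).trans (max_le ((hcomp _ _ hQ).trans (by omega)) ?_)
    refine Polynomial.natDegree_mul_le.trans ?_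
    have h1 := hcomp Q.derivative (2 * k - 1) (Q.natDegree_derivative_le.trans (by omega))
    have h2 := Polynomial.natDegree_C_mul_X_pow_le e 2
    omega
  have hT : ∀ t, T.eval t = Q.eval (s * t) + Q.derivative.eval (s * t) * (e * t ^ 2) := fun t => by
    simp [T, ℓ]
  refine G.sum_le_integral_add (Q.continuous.comp hτ) hTd fun t ht => ?_
  have hst : |s * t| ≤ S := by
    rw [abs_mul]
    exact (mul_le_of_le_one_right (abs_nonneg _) (abs_le.2 ht)).trans hsS
  have hseg : ∀ x ∈ uIcc (s * t) (τ t), |x| ≤ S := fun x hx =>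
    abs_le.2 (uIcc_subset_Icc (abs_le.1 hst) (abs_le.1 (hτS t ht)) hx)
  have h1 := abs_taylor_one_le (f := fun x => Q.eval x) (f' := fun x => Q.derivative.eval x)
    (f'' := fun x => Q.derivative.derivative.eval x) (fun x => Q.hasDerivAt x)
    (fun x => Q.derivative.hasDerivAt x) (fun x hx => (hN x (hseg x hx)).2)
  have h2 : |Q.derivative.eval (s * t) * (τ t - s * t - e * t ^ 2)| ≤ N * δ := by
    rw [abs_mul]
    exact mul_le_mul (hN _ hst).1 (hδ t ht) (abs_nonneg _) hN0
  have h3 : N * |τ t - s * t| ^ 2 ≤ N * δ' ^ 2 := by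
    gcongr
    exact hδ' t ht
  rw [hT, Function.comp_apply]
  calc _ = |(Q.eval (τ t) - Q.eval (s * t) - Q.derivative.eval (s * t) * (τ t - s * t))
        + Q.derivative.eval (s * t) * (τ t - s * t - e * t ^ 2)| := by congr 1; ring
    _ ≤ _ := abs_add_le _ _
    _ ≤ _ := by linarith

/-- The rule transported to an interval integrates polynomials of degree at most `2 k + 1`
exactly. -/
theorem sum_eq_integral {P : Polynomial ℝ} (hP : P.natDegree ≤ 2 * k + 1) (a b : ℝ) :
    ∑ i, G.weight i / 2 * (b - a) * P.eval ((a + b) / 2 + G.point i * ((b - a) / 2))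
      = ∫ x in a..b, P.eval x := by
  let Q : Polynomial ℝ := P.comp
    (Polynomial.C ((b - a) / 2) * Polynomial.X + Polynomial.C ((a + b) / 2))
  have hQd : Q.natDegree ≤ 2 * k + 1 := by
    refine Polynomial.natDegree_comp_le.trans ?_
    calc _ ≤ (2 * k + 1) * 1 := Nat.mul_le_mul hP Polynomial.natDegree_linear_le
      _ = _ := mul_one _
  have hQ : ∀ t, Q.eval t = P.eval ((b - a) / 2 * t + (a + b) / 2) := fun t => by simp [Q]
  have h := G.exact Q hQd
  simp only [hQ] at h
  have h2 := intervalIntegral.mul_integral_comp_mul_add (a := -1) (b := 1)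
    (f := fun x => P.eval x) ((b - a) / 2) ((a + b) / 2)
  rw [show (b - a) / 2 * -1 + (a + b) / 2 = a by ring,
    show (b - a) / 2 * 1 + (a + b) / 2 = b by ring] at h2
  rw [← h2, h, Finset.mul_sum]
  refine Finset.sum_congr rfl fun i _ => ?_
  rw [show (a + b) / 2 + G.point i * ((b - a) / 2) = (b - a) / 2 * G.point i + (a + b) / 2 by ring]
  ring

end GaussRule

/-- Quadrature of a nonnegative polynomial of degree `2 k` along a characteristic, on one
interval. -/
theorem exists_gauss_comp_le (k : ℕ) (h₀ : ℝ) (hh₀ : 0 < h₀) {c₀ K : ℝ} (hc₀ : 0 < c₀) (hK : 0 ≤ K) :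
    ∃ C, 0 ≤ C ∧ ∀ (σ : ℝ → ℝ) (c h : ℝ) (y : ℝ → ℝ) (G : GaussRule k), SmoothBounds σ k K →
      |c| ≤ 2 → 0 < h → h ≤ h₀ → IsCharacteristic σ h c c₀ K y → ∀ a b, a < b →
      ∀ P : Polynomial ℝ, P.natDegree ≤ 2 * k → (∀ x, 0 ≤ P.eval x) →
      ∑ i, G.weight i / 2 * (b - a) * P.eval (y ((a + b) / 2 + G.point i * ((b - a) / 2)))
        ≤ (1 + C * (h + √h * (b - a) ^ 2)) * ∫ x in a..b, P.eval (y x) := by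
  set Λ := 1 + 2 * √h₀ * K + K * h₀ with hΛ
  have hH : 0 ≤ √h₀ := Real.sqrt_nonneg _
  have hΛ0 : 0 ≤ Λ := by positivity
  -- The rescaled map `τ` sends `[-1, 1]` into `[-Λ, Λ]`, where `Q'` and `Q''` must be bounded, and
  -- its image contains `[-c₀, c₀]`, where the integral of `Q` can be recovered.
  obtain ⟨A, hA, hinv⟩ := exists_inverse_inequality (2 * k) hc₀ hΛ0
  refine ⟨4 * A * Λ * (2 * K + (K + (4 * K + K * √h₀) ^ 2)), by positivity,
    fun σ c h y G hσ hc hh hhh hy a b hab P hP hP0 => ?_⟩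
  have hr : 0 ≤ √h := Real.sqrt_nonneg h
  have hr2 : √h * √h = h := Real.mul_self_sqrt hh.le
  have hrH : √h ≤ √h₀ := Real.sqrt_le_sqrt hhh
  have hcont := hy.continuous hσ hc hh
  set m := (a + b) / 2 with hm
  set l := (b - a) / 2 with hl
  have hl0 : 0 < l := by rw [hl]; linarith
  have hInt0 : 0 ≤ ∫ x in a..b, P.eval (y x) :=
    intervalIntegral.integral_nonneg hab.le fun x _ => hP0 _
  let τ : ℝ → ℝ := fun t => (y (l * t + m) - y m) / l
  let Q : Polynomial ℝ := P.comp (Polynomial.C l * Polynomial.X + Polynomial.C (y m))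
  have hQd : Q.natDegree ≤ 2 * k := by
    refine Polynomial.natDegree_comp_le.trans ?_
    calc _ ≤ (2 * k) * 1 := Nat.mul_le_mul hP Polynomial.natDegree_linear_le
      _ = _ := mul_one _
  have hQ : ∀ t, Q.eval t = P.eval (l * t + y m) := fun t => by simp [Q]
  have hQτ : ∀ t, Q.eval (τ t) = P.eval (y (l * t + m)) := fun t => by
    rw [hQ]; congr 1; simp only [τ]; field_simp; ring
  have hI : ∫ x in a..b, P.eval (y x) = l * ∫ t in (-1 : ℝ)..1, Q.eval (τ t) := by
    simp only [hQτ]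
    rw [intervalIntegral.mul_integral_comp_mul_add (f := fun x => P.eval (y x)),
      show l * -1 + m = a by rw [hl, hm]; ring, show l * 1 + m = b by rw [hl, hm]; ring]
  have hsum : ∑ i, G.weight i / 2 * (b - a) * P.eval (y (m + G.point i * l))
      = l * ∑ i, G.weight i * Q.eval (τ (G.point i)) := by
    rw [Finset.mul_sum]
    refine Finset.sum_congr rfl fun i _ => ?_
    rw [hQτ, show l * G.point i + m = m + G.point i * l by ring, hl]
    ring
  rw [hsum]
  -- For `k = 0` the integrand is constant and the rule exact; the third order Taylor estimate,
  -- which needs more than `σ ∈ C²`, is then not required.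
  rcases Nat.eq_zero_or_pos k with rfl | hk
  · obtain ⟨p, hp⟩ : ∃ p, Q = Polynomial.C p := ⟨_, Polynomial.eq_C_of_natDegree_le_zero hQd⟩
    have h1 : l * ∑ i, G.weight i * Q.eval (τ (G.point i)) = ∫ x in a..b, P.eval (y x) := by
      rw [hI, hp]
      simp only [Polynomial.eval_C]
      rw [← Finset.sum_mul, G.sum_weight, intervalIntegral.integral_const]
      norm_num
    rw [h1]
    refine le_mul_of_one_le_left hInt0 ?_
    have : 0 ≤ 4 * A * Λ * (2 * K + (K + (4 * K + K * √h₀) ^ 2)) * (h + √h * (b - a) ^ 2) := by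
      positivity
    linarith
  set N := A * ∫ x in (-c₀)..c₀, |Q.eval x| with hN
  have htl : ∀ t ∈ Icc (-1 : ℝ) 1, |l * t| ≤ l := fun t ht => by
    rw [abs_mul, abs_of_pos hl0]; exact mul_le_of_le_one_right hl0.le (abs_le.2 ht)
  have hτcont : Continuous τ := by
    simp only [τ]
    exact ((hcont.comp (by fun_prop)).sub continuous_const).div_const _
  have hτS : ∀ t ∈ Icc (-1 : ℝ) 1, |τ t| ≤ Λ := fun t ht => by
    rw [abs_div, abs_of_pos hl0, div_le_iff₀ hl0]
    refine (hy.abs_sub_le hσ hc hh hhh _ _).trans ?_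
    rw [add_sub_cancel_right]
    exact mul_le_mul_of_nonneg_left (htl t ht) hΛ0
  have hcr : ∀ z : ℝ, |c * √h * z| ≤ 2 * √h * |z| := fun z => by
    rw [abs_mul, abs_mul, abs_of_nonneg hr]; gcongr
  have hsS : |1 + c * √h * deriv σ m| ≤ Λ := by
    have h1 := abs_add_le 1 (c * √h * deriv σ m)
    have h2 := hcr (deriv σ m)
    have h3 : 2 * √h * |deriv σ m| ≤ 2 * √h₀ * K := by
      gcongr
      exact hσ.deriv_bdd m
    have h4 : 0 ≤ K * h₀ := by positivity
    rw [abs_one] at h1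
    linarith
  have hdrift : ∀ t ∈ Icc (-1 : ℝ) 1, |(y (l * t + m) - (l * t + m) - c * √h * σ (l * t + m))
      - (y m - m - c * √h * σ m)| ≤ K * h * l := fun t ht => by
    refine (hy.drift_lip _ _).trans ?_
    rw [add_sub_cancel_right]
    exact mul_le_mul_of_nonneg_left (htl t ht) (by positivity)
  -- The Taylor remainder of `σ` gives `√h l³ / l`, the drift gives `h l / l`.
  have hδ : ∀ t ∈ Icc (-1 : ℝ) 1,
      |τ t - (1 + c * √h * deriv σ m) * t - c * √h * (deriv (deriv σ) m / 2) * l * t ^ 2|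
        ≤ 2 * √h * (K * l ^ 2) + K * h := fun t ht => by
    have h1 := (hσ.taylor.resolve_left (by omega)) (l * t + m) m
    rw [add_sub_cancel_right] at h1
    have h2 : |l * t| ^ 3 ≤ l ^ 3 := by gcongr; exact htl t ht
    have h3 := hcr (σ (l * t + m) - σ m - deriv σ m * (l * t) - deriv (deriv σ) m / 2 * (l * t) ^ 2)
    have h4 : 2 * √h * |σ (l * t + m) - σ m - deriv σ m * (l * t)
        - deriv (deriv σ) m / 2 * (l * t) ^ 2| ≤ 2 * √h * (K * l ^ 3) := by
      gcongr
      exact h1.trans (by gcongr)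
    have e : τ t - (1 + c * √h * deriv σ m) * t - c * √h * (deriv (deriv σ) m / 2) * l * t ^ 2
        = (((y (l * t + m) - (l * t + m) - c * √h * σ (l * t + m)) - (y m - m - c * √h * σ m))
          + c * √h * (σ (l * t + m) - σ m - deriv σ m * (l * t)
            - deriv (deriv σ) m / 2 * (l * t) ^ 2)) / l := by
      simp only [τ]; field_simp; ring
    rw [e, abs_div, abs_of_pos hl0, div_le_iff₀ hl0]
    refine (abs_add_le _ _).trans ?_
    have h5 := hdrift t ht
    linarith
  -- Only the square of this bound enters the error, so the crude order `√h` is enough.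
  have hδ' : ∀ t ∈ Icc (-1 : ℝ) 1,
      |τ t - (1 + c * √h * deriv σ m) * t| ≤ √h * (4 * K + K * √h₀) := fun t ht => by
    have h1 : |σ (l * t + m) - σ m - deriv σ m * (l * t)| ≤ 2 * (K * l) := by
      have e1 : |σ (l * t + m) - σ m| ≤ K * l := by
        refine (hσ.lip _ _).trans ?_
        rw [add_sub_cancel_right]
        exact mul_le_mul_of_nonneg_left (htl t ht) hK
      have e2 : |deriv σ m * (l * t)| ≤ K * l := by
        rw [abs_mul]
        exact mul_le_mul (hσ.deriv_bdd m) (htl t ht) (abs_nonneg _) hK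
      exact (abs_sub _ _).trans (by linarith)
    have h3 := hcr (σ (l * t + m) - σ m - deriv σ m * (l * t))
    have h4 : 2 * √h * |σ (l * t + m) - σ m - deriv σ m * (l * t)| ≤ 2 * √h * (2 * (K * l)) := by
      gcongr
    have e : τ t - (1 + c * √h * deriv σ m) * t
        = (((y (l * t + m) - (l * t + m) - c * √h * σ (l * t + m)) - (y m - m - c * √h * σ m))
          + c * √h * (σ (l * t + m) - σ m - deriv σ m * (l * t))) / l := by
      simp only [τ]; field_simp; ring
    rw [e, abs_div, abs_of_pos hl0, div_le_iff₀ hl0]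
    refine (abs_add_le _ _).trans ?_
    have h5 := hdrift t ht
    have h6 : K * h * l ≤ √h * (K * √h₀) * l := by
      have : K * (√h * √h) * l ≤ K * (√h * √h₀) * l := by gcongr
      rw [hr2] at this
      linarith
    linarith
  have hmain := G.sum_comp_le_integral_comp_add hk hQd hτcont hτS hsS hδ hδ' (hinv Q hQd)
  -- The interval of radius `c₀ l` around `y(m)` lies in `(y a, y b)` by the lower slope bound. As
  -- `P ≥ 0`, the integral may be enlarged and then pulled back to `(a, b)`.
  have hlN : l * ∫ x in (-c₀)..c₀, |Q.eval x| ≤ Λ * ∫ x in a..b, P.eval (y x) := by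
    have h1 : ∫ x in (-c₀)..c₀, |Q.eval x| = ∫ x in (-c₀)..c₀, P.eval (l * x + y m) :=
      intervalIntegral.integral_congr fun x _ => by simp only [hQ, abs_of_nonneg (hP0 _)]
    rw [h1, intervalIntegral.mul_integral_comp_mul_add (f := fun x => P.eval x)]
    refine le_trans ?_
      (hy.integral_le_integral_comp hσ hc hh hhh hc₀ P.continuous hP0 hab.le)
    have ha := hy.lower a m (by rw [hm]; linarith)
    have hb := hy.lower m b (by rw [hm]; linarith)
    rw [show m - a = l by rw [hm, hl]; ring] at ha
    rw [show b - m = l by rw [hm, hl]; ring] at hb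
    have hlc : 0 ≤ l * c₀ := by positivity
    exact intervalIntegral.integral_mono_interval (by linarith) (by linarith) (by linarith)
      (Filter.Eventually.of_forall fun x => hP0 x) (P.continuous.intervalIntegrable _ _)
  set D := 2 * √h * (K * l ^ 2) + K * h + (√h * (4 * K + K * √h₀)) ^ 2 with hD
  have hD0 : 0 ≤ D := by positivity
  have hDle : D ≤ (2 * K + (K + (4 * K + K * √h₀) ^ 2)) * (h + √h * (b - a) ^ 2) := by
    have h1 : (√h * (4 * K + K * √h₀)) ^ 2 = (4 * K + K * √h₀) ^ 2 * h := by
      linear_combination (4 * K + K * √h₀) ^ 2 * hr2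
    have h2 : l ^ 2 ≤ (b - a) ^ 2 := by gcongr; rw [hl]; linarith
    have h3 : 2 * √h * (K * l ^ 2) ≤ 2 * √h * (K * (b - a) ^ 2) := by gcongr
    have h4 : 0 ≤ 2 * K * h := by positivity
    have h5 : 0 ≤ (K + (4 * K + K * √h₀) ^ 2) * (√h * (b - a) ^ 2) := by positivity
    rw [hD, h1]
    linarith
  calc l * ∑ i, G.weight i * Q.eval (τ (G.point i))
      ≤ l * ((∫ t in (-1 : ℝ)..1, Q.eval (τ t)) + 4 * (N * D)) :=
        mul_le_mul_of_nonneg_left hmain hl0.le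
    _ = (∫ x in a..b, P.eval (y x)) + 4 * A * D * (l * ∫ x in (-c₀)..c₀, |Q.eval x|) := by
        rw [hI, hN]; ring
    _ ≤ (∫ x in a..b, P.eval (y x)) + 4 * A * D * (Λ * ∫ x in a..b, P.eval (y x)) := by gcongr
    _ = (1 + 4 * A * Λ * D) * ∫ x in a..b, P.eval (y x) := by ring
    _ ≤ (1 + 4 * A * Λ * ((2 * K + (K + (4 * K + K * √h₀) ^ 2)) * (h + √h * (b - a) ^ 2)))
          * ∫ x in a..b, P.eval (y x) := by gcongr
    _ = _ := by ring

/-! ### The quadrature product on the whole mesh -/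

/-- On every cell of the periodically extended mesh an element of `V_k` is a polynomial. -/
theorem exists_polynomial_on_cell {k M : ℕ} (hM : 1 ≤ M) {u : ℝ → ℝ} (hu : u ∈ dgSpace k M)
    (j : ℤ) : ∃ p : Polynomial ℝ, p.natDegree ≤ k ∧
      ∀ x ∈ Ico ((j : ℝ) / M) (((j : ℝ) + 1) / M), u x = p.eval x := by
  have hM0 : (0 : ℝ) < M := by exact_mod_cast hM
  have hMZ : (0 : ℤ) < M := by exact_mod_cast hM
  obtain ⟨i, hi⟩ := Int.eq_ofNat_of_zero_le (Int.emod_nonneg j hMZ.ne')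
  have hiM : i < M := by
    have := Int.emod_lt_of_pos j hMZ
    omega
  obtain ⟨p, hp, hpu⟩ := hu.2 i hiM
  have hj : (j : ℝ) = i + M * ((j / M : ℤ) : ℝ) := by
    have := Int.emod_add_mul_ediv j M
    rw [hi] at this
    exact_mod_cast this.symm
  refine ⟨p.comp (Polynomial.X - Polynomial.C ((j / M : ℤ) : ℝ)), ?_, fun x hx => ?_⟩
  · refine Polynomial.natDegree_comp_le.trans ?_
    rw [Polynomial.natDegree_X_sub_C, mul_one]
    exact hp
  · have h1 : u x = u (x - ((j / M : ℤ) : ℝ)) := by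
      have := hu.1.sub_int_mul_eq (x := x) (j / M)
      rw [mul_one] at this
      exact this.symm
    rw [h1, hpu, Polynomial.eval_comp, Polynomial.eval_sub, Polynomial.eval_X, Polynomial.eval_C]
    rw [hj] at hx
    have e1 : ((i : ℝ) + M * ((j / M : ℤ) : ℝ)) / M = i / M + ((j / M : ℤ) : ℝ) := by
      field_simp
    have e2 : ((i : ℝ) + M * ((j / M : ℤ) : ℝ) + 1) / M = (i + 1) / M + ((j / M : ℤ) : ℝ) := by
      field_simp; ring
    rw [e1, e2] at hx
    exact ⟨by linarith [hx.1], by linarith [hx.2]⟩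

section GaussProd

variable {k M : ℕ} {y : ℝ → ℝ} (G : GaussRule k) (P : RegularPartition M y)

/-- Strict interiority matters: the polynomial formulas for `u` and `u ∘ y` are available on the
open intervals only. -/
theorem gauss_point_mem {a b : ℝ} (hab : a < b) (i : Fin (k + 1)) :
    (a + b) / 2 + G.point i * ((b - a) / 2) ∈ Ioo a b := by
  have h := G.point_mem i
  constructor <;> nlinarith [h.1, h.2]

theorem gaussProd_add (f g₁ g₂ : ℝ → ℝ) :
    gaussProd G P f (g₁ + g₂) = gaussProd G P f g₁ + gaussProd G P f g₂ := by
  simp only [gaussProd, Pi.add_apply, mul_add, Finset.sum_add_distrib]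

theorem gaussProd_smul (c : ℝ) (f g : ℝ → ℝ) :
    gaussProd G P f (c • g) = c * gaussProd G P f g := by
  simp only [gaussProd, Pi.smul_apply, smul_eq_mul, Finset.mul_sum]
  refine Finset.sum_congr rfl fun l _ => Finset.sum_congr rfl fun a _ => ?_
  ring

/-- Young's inequality at each quadrature point; positivity of the weights preserves it. -/
theorem gaussProd_le_add_half (f g : ℝ → ℝ) :
    gaussProd G P f g ≤ 1 / 2 * gaussProd G P f f + 1 / 2 * gaussProd G P g g := by
  simp only [gaussProd, Finset.mul_sum, ← Finset.sum_add_distrib]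
  refine Finset.sum_le_sum fun l hl => Finset.sum_le_sum fun a _ => ?_
  have h1 := P.node_lt l (Finset.mem_range.1 hl)
  have h2 : 0 ≤ G.weight a / 2 * (P.node (l + 1) - P.node l) :=
    mul_nonneg (by linarith [G.weight_pos a]) (by linarith)
  generalize f _ = s
  generalize g _ = t
  linarith [mul_nonneg h2 (sq_nonneg (s - t))]

theorem sum_integral_partition {f : ℝ → ℝ} (hf : ∀ a b, IntervalIntegrable f volume a b) :
    ∑ l ∈ Finset.range P.n, ∫ x in (P.node l)..(P.node (l + 1)), f x = ∫ x in (0 : ℝ)..1, f x := by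
  rw [intervalIntegral.sum_integral_adjacent_intervals (fun _ _ => hf _ _), P.node_zero,
    P.node_last]

/-- The quadrature product is exact on `V_k × V_k`. -/
theorem gaussProd_eq_integral (hM : 1 ≤ M) {u v : ℝ → ℝ} (hu : u ∈ dgSpace k M)
    (hv : v ∈ dgSpace k M) : gaussProd G P u v = ∫ x in (0 : ℝ)..1, u x * v x := by
  rw [← sum_integral_partition P (f := fun x => u x * v x)
    (intervalIntegrable_of_measurable_of_bounded
    ((measurable_of_mem_dgSpace hM hu).mul (measurable_of_mem_dgSpace hM hv))
    (bounded_mul (bounded_of_mem_dgSpace hM hu) (bounded_of_mem_dgSpace hM hv)))]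
  refine Finset.sum_congr rfl fun l hl => ?_
  have hlt := P.node_lt l (Finset.mem_range.1 hl)
  obtain ⟨i, hi, hsub⟩ := P.sub_cell l (Finset.mem_range.1 hl)
  obtain ⟨p, hp, hpu⟩ := hu.2 i hi
  obtain ⟨q, hq, hqv⟩ := hv.2 i hi
  have heq : ∀ x ∈ Ioo (P.node l) (P.node (l + 1)), u x * v x = (p * q).eval x := fun x hx => by
    rw [hpu x (Ioo_subset_Ico_self (hsub hx)), hqv x (Ioo_subset_Ico_self (hsub hx)),
      Polynomial.eval_mul]
  have hpq : (p * q).natDegree ≤ 2 * k + 1 := Polynomial.natDegree_mul_le.trans (by omega)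
  rw [intervalIntegral.integral_congr_Ioo_of_le hlt.le heq, ← G.sum_eq_integral hpq]
  refine Finset.sum_congr rfl fun a _ => ?_
  rw [heq _ (gauss_point_mem G hlt a)]

end GaussProd

/-- Quadrature of `(u ∘ y)²` for `u ∈ V_k` along a characteristic. -/
theorem exists_gaussProd_comp_le (k : ℕ) (h₀ : ℝ) (hh₀ : 0 < h₀) {c₀ K : ℝ} (hc₀ : 0 < c₀)
    (hK : 0 ≤ K) :
    ∃ C, 0 ≤ C ∧ ∀ (σ : ℝ → ℝ) (c h : ℝ) (y : ℝ → ℝ) (G : GaussRule k), SmoothBounds σ k K →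
      |c| ≤ 2 → 0 < h → h ≤ h₀ → IsCharacteristic σ h c c₀ K y → ∀ M : ℕ, 1 ≤ M →
      ∀ (P : RegularPartition M y), ∀ u ∈ dgSpace k M,
      gaussProd G P (fun x => u (y x)) (fun x => u (y x))
        ≤ (1 + C * (h + √h * (1 / (M : ℝ)) ^ 2)) * ∫ x in (0 : ℝ)..1, u (y x) ^ 2 := by
  obtain ⟨C, hC, hloc⟩ := exists_gauss_comp_le k h₀ hh₀ hc₀ hK
  refine ⟨C, hC, fun σ c h y G hσ hc hh hhh hy M hM P u hu => ?_⟩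
  have hM0 : (0 : ℝ) < M := by exact_mod_cast hM
  have hum := (measurable_of_mem_dgSpace hM hu).comp (hy.continuous hσ hc hh).measurable
  have hub : ∃ C, ∀ x, |u (y x)| ≤ C := by
    obtain ⟨D, hD⟩ := bounded_of_mem_dgSpace hM hu
    exact ⟨D, fun x => hD _⟩
  simp only [pow_two (u _)]
  rw [← sum_integral_partition P (f := fun x => u (y x) * u (y x))
    (intervalIntegrable_of_measurable_of_bounded
    (hum.mul hum) (bounded_mul hub hub)), Finset.mul_sum]
  refine Finset.sum_le_sum fun l hl => ?_
  have hl' := Finset.mem_range.1 hl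
  have hlt := P.node_lt l hl'
  obtain ⟨i, -, hsub⟩ := P.sub_cell l hl'
  obtain ⟨j, hj⟩ := P.image_sub_cell l hl'
  obtain ⟨p, hp, hpu⟩ := exists_polynomial_on_cell hM hu j
  have heq : ∀ x ∈ Ioo (P.node l) (P.node (l + 1)), u (y x) * u (y x) = (p * p).eval (y x) :=
    fun x hx => by
      rw [hpu _ (Ioo_subset_Ico_self (hj (mem_image_of_mem y hx))), Polynomial.eval_mul]
  -- Each interval lies in one cell, which is how `Δx` enters the local error.
  have hlen : P.node (l + 1) - P.node l ≤ 1 / M := by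
    obtain ⟨h1, h2⟩ := (Ioo_subset_Ioo_iff hlt).1 hsub
    rw [add_div] at h2
    linarith
  have hI : ∫ x in (P.node l)..(P.node (l + 1)), u (y x) * u (y x)
      = ∫ x in (P.node l)..(P.node (l + 1)), (p * p).eval (y x) :=
    intervalIntegral.integral_congr_Ioo_of_le hlt.le heq
  have hmain := hloc σ c h y G hσ hc hh hhh hy _ _ hlt (p * p)
    (Polynomial.natDegree_mul_le.trans (by omega))
    (fun x => by rw [Polynomial.eval_mul]; exact mul_self_nonneg _)
  calc _ = ∑ i, G.weight i / 2 * (P.node (l + 1) - P.node l) * (p * p).eval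
        (y ((P.node l + P.node (l + 1)) / 2 + G.point i * ((P.node (l + 1) - P.node l) / 2))) :=
        Finset.sum_congr rfl fun a _ => by
          rw [← heq _ (gauss_point_mem G hlt a)]
    _ ≤ _ := hmain
    _ ≤ _ := by
      rw [hI]
      refine mul_le_mul_of_nonneg_right ?_ (intervalIntegral.integral_nonneg hlt.le fun x _ => by
        rw [Polynomial.eval_mul]; exact mul_self_nonneg _)
      gcongr

/-! ### Energy estimates for one step -/

/-- For `X ≥ 1` one has `√X ≤ X`; the sharper factor is not needed for a bound of the form `1 + C
h`. -/
theorem l2norm_le_of_integral_sq_le {u v : ℝ → ℝ} {X : ℝ} (hX : 1 ≤ X)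
    (h : ∫ x in (0 : ℝ)..1, v x ^ 2 ≤ X * ∫ x in (0 : ℝ)..1, u x ^ 2) :
    l2norm v ≤ X * l2norm u := by
  have hu : 0 ≤ ∫ x in (0 : ℝ)..1, u x ^ 2 :=
    intervalIntegral.integral_nonneg zero_le_one fun x _ => sq_nonneg _
  refine (Real.sqrt_le_sqrt (h.trans (?_ : _ ≤ X ^ 2 * ∫ x in (0 : ℝ)..1, u x ^ 2))).trans_eq ?_
  · gcongr; nlinarith
  · rw [Real.sqrt_mul (sq_nonneg X), Real.sqrt_sq (by linarith)]; rfl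

namespace Scheme

theorem weight_nonneg (s : Scheme) (j : Fin s.numPaths) : 0 ≤ s.weight j := by
  cases s
  · change Fin 2 at j
    fin_cases j <;> norm_num [weight]
  · change Fin 3 at j
    fin_cases j <;> norm_num [weight]

theorem sum_weight (s : Scheme) : ∑ j, s.weight j = 1 := by
  cases s
  · refine (Fin.sum_univ_two (M := ℝ) _).trans ?_
    norm_num [weight]
  · refine (Fin.sum_univ_three (M := ℝ) _).trans ?_
    change (1 / 6 : ℝ) + 2 / 3 + 1 / 6 = 1
    norm_num

variable {s : Scheme} {b σ : ℝ → ℝ} {k M : ℕ} {h : ℝ}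

theorem existsUnique_exactStep (hM : 1 ≤ M) (hy : ∀ j, Measurable (s.charMap b σ h j)) {u : ℝ → ℝ}
    (hu : u ∈ dgSpace k M) : ∃! v, s.IsExactStep b σ k M h u v := by
  set w : ℝ → ℝ := fun x => ∑ j, s.weight j * u (s.charMap b σ h j x) with hw
  have hwm : Measurable w := Finset.measurable_sum _ fun j _ =>
    ((measurable_of_mem_dgSpace hM hu).comp (hy j)).const_mul _
  have hwb : ∃ C, ∀ x, |w x| ≤ C := by
    obtain ⟨C, hC⟩ := bounded_of_mem_dgSpace hM hu
    refine ⟨∑ j, s.weight j * C, fun x => (Finset.abs_sum_le_sum_abs _ _).trans ?_⟩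
    refine Finset.sum_le_sum fun j _ => ?_
    rw [abs_mul, abs_of_nonneg (s.weight_nonneg j)]
    exact mul_le_mul_of_nonneg_left (hC _) (s.weight_nonneg j)
  have hint : ∀ φ ∈ dgSpace k M, IntervalIntegrable (fun x => w x * φ x) volume 0 1 := fun φ hφ =>
    intervalIntegrable_of_measurable_of_bounded (hwm.mul (measurable_of_mem_dgSpace hM hφ))
      (bounded_mul hwb (bounded_of_mem_dgSpace hM hφ)) 0 1
  refine existsUnique_dg_representative hM (fun φ => ∫ x in (0 : ℝ)..1, w x * φ x)
    (fun φ hφ ψ hψ => ?_) (fun c φ hφ => ?_)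
  · rw [← intervalIntegral.integral_add (hint φ hφ) (hint ψ hψ)]
    simp only [Pi.add_apply, mul_add]
  · rw [← intervalIntegral.integral_const_mul]
    simp only [Pi.smul_apply, smul_eq_mul, mul_left_comm]

theorem existsUnique_quadStep (hM : 1 ≤ M) (G : GaussRule k)
    (P : ∀ j, RegularPartition M (s.charMap b σ h j)) (u : ℝ → ℝ) :
    ∃! v, s.IsQuadStep b σ h G P u v := by
  refine existsUnique_dg_representative hM
    (fun φ => ∑ j, s.weight j * gaussProd G (P j) (fun x => u (s.charMap b σ h j x)) φ)
    (fun φ _ ψ _ => ?_) (fun c φ _ => ?_)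
  · simp only [gaussProd_add, mul_add, Finset.sum_add_distrib]
  · simp only [gaussProd_smul, Finset.mul_sum, mul_left_comm]

/-- The result `v` is its own test function. Young's inequality and `∑ α_q = 1` leave `½ ‖v‖²` on
the right, which is absorbed. -/
theorem sq_le_of_exactStep (hM : 1 ≤ M) (hy : ∀ j, Measurable (s.charMap b σ h j)) {u v : ℝ → ℝ}
    (hu : u ∈ dgSpace k M) (hv : s.IsExactStep b σ k M h u v) :
    ∫ x in (0 : ℝ)..1, v x ^ 2
      ≤ ∑ j, s.weight j * ∫ x in (0 : ℝ)..1, u (s.charMap b σ h j x) ^ 2 := by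
  have hvm := measurable_of_mem_dgSpace hM hv.1
  have hvb := bounded_of_mem_dgSpace hM hv.1
  have hum : ∀ j, Measurable fun x => u (s.charMap b σ h j x) := fun j =>
    (measurable_of_mem_dgSpace hM hu).comp (hy j)
  have hub : ∀ j, ∃ C, ∀ x, |u (s.charMap b σ h j x)| ≤ C := fun j => by
    obtain ⟨C, hC⟩ := bounded_of_mem_dgSpace hM hu
    exact ⟨C, fun x => hC _⟩
  have hint : ∀ {f g : ℝ → ℝ}, Measurable f → Measurable g → (∃ C, ∀ x, |f x| ≤ C) →
      (∃ C, ∀ x, |g x| ≤ C) → IntervalIntegrable (fun x => f x * g x) volume 0 1 :=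
    fun hf hg hf' hg' => intervalIntegrable_of_measurable_of_bounded (hf.mul hg)
      (bounded_mul hf' hg') 0 1
  have h1 : ∫ x in (0 : ℝ)..1, v x * v x
      = ∑ j, s.weight j * ∫ x in (0 : ℝ)..1, u (s.charMap b σ h j x) * v x := by
    rw [hv.2 v hv.1]
    simp only [Finset.sum_mul, mul_assoc]
    rw [intervalIntegral.integral_finsetSum fun j _ =>
      (hint (hum j) hvm (hub j) hvb).const_mul _]
    simp only [intervalIntegral.integral_const_mul]
  have h2 : ∀ j, ∫ x in (0 : ℝ)..1, u (s.charMap b σ h j x) * v x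
      ≤ 1 / 2 * (∫ x in (0 : ℝ)..1, u (s.charMap b σ h j x) * u (s.charMap b σ h j x))
        + 1 / 2 * ∫ x in (0 : ℝ)..1, v x * v x := fun j => by
    have i1 := (hint (hum j) (hum j) (hub j) (hub j)).const_mul (1 / 2)
    have i2 := (hint hvm hvm hvb hvb).const_mul (1 / 2)
    rw [← intervalIntegral.integral_const_mul, ← intervalIntegral.integral_const_mul,
      ← intervalIntegral.integral_add i1 i2]
    refine intervalIntegral.integral_mono_on zero_le_one (hint (hum j) hvm (hub j) hvb)
      (i1.add i2) fun x _ => ?_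
    nlinarith [sq_nonneg (u (s.charMap b σ h j x) - v x)]
  have h3 := Finset.sum_le_sum fun j (_ : j ∈ Finset.univ) =>
    mul_le_mul_of_nonneg_left (h2 j) (s.weight_nonneg j)
  rw [← h1] at h3
  simp only [mul_add, Finset.sum_add_distrib] at h3
  rw [← Finset.sum_mul, s.sum_weight, one_mul] at h3
  simp only [mul_left_comm _ (1 / 2 : ℝ), ← Finset.mul_sum] at h3
  simp only [pow_two]
  linarith

/-- The same absorption with Gauss sums: it works for every partition because `(v, v)_G` equals
`‖v‖²` exactly. -/
theorem sq_le_of_quadStep (hM : 1 ≤ M) {G : GaussRule k}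
    {P : ∀ j, RegularPartition M (s.charMap b σ h j)} {u v : ℝ → ℝ}
    (hv : s.IsQuadStep b σ h G P u v) :
    ∫ x in (0 : ℝ)..1, v x ^ 2
      ≤ ∑ j, s.weight j * gaussProd G (P j) (fun x => u (s.charMap b σ h j x))
          (fun x => u (s.charMap b σ h j x)) := by
  have h3 := Finset.sum_le_sum fun j (_ : j ∈ Finset.univ) =>
    mul_le_mul_of_nonneg_left (gaussProd_le_add_half G (P j)
      (fun x => u (s.charMap b σ h j x)) v) (s.weight_nonneg j)
  rw [← hv.2 v hv.1] at h3
  simp only [gaussProd_eq_integral G _ hM hv.1 hv.1, mul_add, Finset.sum_add_distrib] at h3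
  rw [← Finset.sum_mul, s.sum_weight, one_mul] at h3
  simp only [mul_left_comm _ (1 / 2 : ℝ), ← Finset.mul_sum] at h3
  simp only [pow_two]
  linarith

end Scheme

/-! ### The stability theorem -/

theorem mainTheorem4 (s : Scheme) (k : ℕ) (b σ : ℝ → ℝ)
    (hb_per : Function.Periodic b 1) (hσ_per : Function.Periodic σ 1)
    (hb : ∃ K, LipschitzWith K b) (hσ : ContDiff ℝ ((2 * k + 2 : ℕ) : WithTop ℕ∞) σ)
    (h₀ : ℝ) (hh₀ : 0 < h₀) (hsmall : s.SmallStep b σ h₀) :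
    -- (i) exact integration
    (∃ C : ℝ, 0 ≤ C ∧ ∀ h : ℝ, 0 < h → h ≤ h₀ → ∀ M : ℕ, 1 ≤ M → ∀ u ∈ dgSpace k M,
      (∃! v, s.IsExactStep b σ k M h u v) ∧
      ∀ v, s.IsExactStep b σ k M h u v → l2norm v ≤ (1 + C * h) * l2norm u) ∧
    -- (ii) Gaussian quadrature
    (∃ C : ℝ, 0 ≤ C ∧ ∀ h : ℝ, 0 < h → h ≤ h₀ → ∀ M : ℕ, 1 ≤ M →
      (∀ j, Nonempty (RegularPartition M (s.charMap b σ h j))) ∧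
      ∀ (G : GaussRule k) (P : ∀ j, RegularPartition M (s.charMap b σ h j)), ∀ u ∈ dgSpace k M,
        (∃! v, s.IsQuadStep b σ h G P u v) ∧
        ∀ v, s.IsQuadStep b σ h G P u v →
          l2norm v ≤ (1 + C * h + C * Real.sqrt h * (1 / (M : ℝ)) ^ 2) * l2norm u) ∧
    -- (iii) stability of the fully discrete scheme under the weak CFL condition
    (∀ lam : ℝ, 0 < lam → ∃ L : ℝ, 0 ≤ L ∧ ∀ h : ℝ, 0 < h → h ≤ h₀ → ∀ M : ℕ, 1 ≤ M →
      (1 / (M : ℝ)) ^ 4 ≤ lam * h →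
      ∀ (G : GaussRule k) (P : ∀ j, RegularPartition M (s.charMap b σ h j)) (U : ℕ → ℝ → ℝ),
        U 0 ∈ dgSpace k M → (∀ n, s.IsQuadStep b σ h G P (U n) (U (n + 1))) →
        ∀ n : ℕ, l2norm (U n) ≤ Real.exp (L * (n * h)) * l2norm (U 0)) := by
  obtain ⟨c, c₀, K, hc₀, hσK, hc, hαc, hchar⟩ :=
    s.exists_isCharacteristic hb_per hσ_per hb hσ hh₀ hsmall
  have hK := hσK.nonneg
  obtain ⟨C₁, hC₁, hmean⟩ : ∃ C₁ : ℝ, 0 ≤ C₁ ∧ ∀ h : ℝ, 0 < h → h ≤ h₀ → ∀ M : ℕ, 1 ≤ M →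
      ∀ u ∈ dgSpace k M, ∑ j, s.weight j * ∫ x in (0 : ℝ)..1, u (s.charMap b σ h j x) ^ 2
        ≤ (1 + C₁ * h) * ∫ x in (0 : ℝ)..1, u x ^ 2 := by
    refine ⟨4 * K * (K * (2 + √h₀) * (1 + 1 / c₀)) + K / c₀, by positivity,
      fun h hh hhh M hM u hu => ?_⟩
    refine sum_integral_comp_le (f := fun x => u x ^ 2) s.weight_nonneg s.sum_weight hαc hσK hc
      hh hhh hc₀ (hchar h hh hhh) ((measurable_of_mem_dgSpace hM hu).pow_const 2)
      (fun x => by simp only [hu.1 x]) (fun x => sq_nonneg _) ?_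
    simp only [pow_two]
    exact bounded_mul (bounded_of_mem_dgSpace hM hu) (bounded_of_mem_dgSpace hM hu)
  obtain ⟨C₂, hC₂, hquad⟩ := exists_gaussProd_comp_le k h₀ hh₀ hc₀ hK
  -- From the product `(1 + C₂ (h + ε)) (1 + C₁ h)`, with `h ≤ h₀` in the mixed term.
  set C := C₁ + C₂ * (1 + C₁ * h₀) with hC
  have hC0 : 0 ≤ C := by positivity
  have hstep : ∀ h : ℝ, 0 < h → h ≤ h₀ → ∀ M : ℕ, 1 ≤ M → ∀ (G : GaussRule k)
      (P : ∀ j, RegularPartition M (s.charMap b σ h j)), ∀ u ∈ dgSpace k M, ∀ v,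
      s.IsQuadStep b σ h G P u v →
        l2norm v ≤ (1 + C * h + C * √h * (1 / (M : ℝ)) ^ 2) * l2norm u := by
    intro h hh hhh M hM G P u hu v hv
    set ε := √h * (1 / (M : ℝ)) ^ 2 with hε
    have hε0 : 0 ≤ ε := by positivity
    have hCε : C * √h * (1 / (M : ℝ)) ^ 2 = C * ε := by rw [hε]; ring
    rw [hCε]
    have hI : 0 ≤ ∫ x in (0 : ℝ)..1, u x ^ 2 :=
      intervalIntegral.integral_nonneg zero_le_one fun x _ => sq_nonneg _
    refine l2norm_le_of_integral_sq_le (by nlinarith [mul_nonneg hC0 hh.le, mul_nonneg hC0 hε0]) ?_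
    calc ∫ x in (0 : ℝ)..1, v x ^ 2
        ≤ ∑ j, s.weight j * gaussProd G (P j) (fun x => u (s.charMap b σ h j x))
          (fun x => u (s.charMap b σ h j x)) := Scheme.sq_le_of_quadStep hM hv
      _ ≤ ∑ j, s.weight j * ((1 + C₂ * (h + ε))
            * ∫ x in (0 : ℝ)..1, u (s.charMap b σ h j x) ^ 2) :=
          Finset.sum_le_sum fun j _ => mul_le_mul_of_nonneg_left
            (hquad σ (c j) h _ G hσK (hc j) hh hhh (hchar h hh hhh j) M hM (P j) u hu)
            (s.weight_nonneg j)
      _ = (1 + C₂ * (h + ε)) * ∑ j, s.weight j * ∫ x in (0 : ℝ)..1, u (s.charMap b σ h j x) ^ 2 := by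
          rw [Finset.mul_sum]
          exact Finset.sum_congr rfl fun j _ => by ring
      _ ≤ (1 + C₂ * (h + ε)) * ((1 + C₁ * h) * ∫ x in (0 : ℝ)..1, u x ^ 2) := by
          gcongr
          exact hmean h hh hhh M hM u hu
      _ = ((1 + C₂ * (h + ε)) * (1 + C₁ * h)) * ∫ x in (0 : ℝ)..1, u x ^ 2 := by ring
      _ ≤ (1 + C * h + C * ε) * ∫ x in (0 : ℝ)..1, u x ^ 2 := by
          refine mul_le_mul_of_nonneg_right ?_ hI
          have h1 : C₂ * (C₁ * h) * (h + ε) ≤ C₂ * (C₁ * h₀) * (h + ε) := by gcongr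
          have h2 : 0 ≤ C₁ * ε := by positivity
          rw [hC]
          linarith
  have hmeas : ∀ h, 0 < h → h ≤ h₀ → ∀ j, Continuous (s.charMap b σ h j) := fun h hh hhh j =>
    (hchar h hh hhh j).continuous hσK (hc j) hh
  refine ⟨⟨C₁, hC₁, fun h hh hhh M hM u hu => ?_⟩, ⟨C, hC0, fun h hh hhh M hM => ?_⟩,
    fun lam hlam => ?_⟩
  · refine ⟨Scheme.existsUnique_exactStep hM (fun j => (hmeas h hh hhh j).measurable) hu,
      fun v hv => l2norm_le_of_integral_sq_le (by nlinarith [mul_nonneg hC₁ hh.le]) ?_⟩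
    exact (Scheme.sq_le_of_exactStep hM (fun j => (hmeas h hh hhh j).measurable) hu hv).trans
      (hmean h hh hhh M hM u hu)
  · exact ⟨fun j => RegularPartition.nonempty hM (hmeas h hh hhh j)
      ((hchar h hh hhh j).strictMono hc₀), fun G P u hu =>
      ⟨Scheme.existsUnique_quadStep hM G P u, hstep h hh hhh M hM G P u hu⟩⟩
  · refine ⟨C * (1 + √lam), by positivity, fun h hh hhh M hM hcfl G P U hU0 hU n => ?_⟩
    have hUmem : ∀ n, U n ∈ dgSpace k M := fun n => by
      cases n with
      | zero => exact hU0
      | succ n => exact (hU n).1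
    have hfac : 1 + C * h + C * √h * (1 / (M : ℝ)) ^ 2 ≤ Real.exp (C * (1 + √lam) * h) := by
      -- The square root of the CFL condition: `√h Δx² ≤ √λ h`, so the quadrature term has the order
      -- of the time step.
      have h1 : (1 / (M : ℝ)) ^ 2 ≤ √lam * √h := by
        rw [← Real.sqrt_mul hlam.le]
        refine Real.le_sqrt_of_sq_le ?_
        calc _ = (1 / (M : ℝ)) ^ 4 := by ring
          _ ≤ _ := hcfl
      have h2 : C * √h * (1 / (M : ℝ)) ^ 2 ≤ C * √h * (√lam * √h) := by gcongr
      have h3 : C * √h * (√lam * √h) = C * √lam * h := by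
        linear_combination C * √lam * Real.mul_self_sqrt hh.le
      have h4 := Real.add_one_le_exp (C * (1 + √lam) * h)
      linarith
    induction n with
    | zero => simp
    | succ n ih =>
      calc l2norm (U (n + 1))
          ≤ (1 + C * h + C * √h * (1 / (M : ℝ)) ^ 2) * l2norm (U n) :=
            hstep h hh hhh M hM G P (U n) (hUmem n) _ (hU n)
        _ ≤ Real.exp (C * (1 + √lam) * h)
            * (Real.exp (C * (1 + √lam) * (n * h)) * l2norm (U 0)) :=
            mul_le_mul hfac ih (Real.sqrt_nonneg _) (Real.exp_pos _).le
        _ = Real.exp (C * (1 + √lam) * ((n + 1 : ℕ) * h)) * l2norm (U 0) := by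
            rw [← mul_assoc, ← Real.exp_add]
            congr 2
            push_cast; ring
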